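/- **Conventions.** For an algebraic number $x$ of degree $k$, let $\mathcal M(x)$ be the Mahler measure of its minimal polynomial over $\mathbb Z$, let $H(x)=\mathcal M(x)^{1/k}$ be its absolute multiplicative height, and put $H(x,y)=\max\{H(x),H(y)\}$. For an entire function $f$ let $M(r,f)=\max_{|z|=r}|f(z)|$; its order and lower order are $$\rho=\limsup_{r\to\infty}\frac{\log\log M(r,f)}{\log r},\qquad \lambda=\liminf_{r\to\infty}\frac{\log\log M(r,f)}{\log r}.$$ For $0<\varphi<\pi/2$ let $S_\varphi=\{z\in\mathbb C:-\varphi\le\arg z\le\varphi\}$ (with $0\in S_\varphi$). **Theorem.** Let $f(z)=\prod_{n=1}^\infty\left(1-\frac{z}{z_n}\right)$ with real zeros $1\le z_1\le z_2\le\cdots$ and $\sum_n 1/z_n<\infty$. Assume that the lower order $\lambda$ and the order $\rho$ of $f$ satisfy $0<\lambda\le\rho\le\frac12$, and that, with $n(r)$ the number of indices $k$ with $z_k<r$, the limit $\mu=\lim_{r\to\infty}n(r)/r^\rho$ exists and lies in $(0,\infty)$. Let $0<\varphi<\pi/2$, let $d\ge1$ be an integer, and set $$\alpha=1+\rho,\qquad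 \beta=\frac{\lambda}{2},\qquad \gamma=\frac{2\alpha+\rho}{\beta\rho}.$$ Then there is a constant $C>0$, independent of $H$, such that for all real $H>e$ there are at most $$C(\log H)^{2\alpha(\gamma+1)/\rho}$$ complex numbers $z\in\mathbb C\setminus S_\varphi$ (the whole unbounded region) with $[\mathbb Q(z,f(z)):\mathbb Q]\le d$ and $H(z,f(z))\le H$. Moreover, $C$ is effective in the following sense. There are computable functions $\kappa:\mathbb N\to\mathbb N$ and $C:\mathbb N^3\to\mathbb N$, not depending on $f$, $\varphi$ or $d$, such that the bound holds with constant $C(d,m,r_1)$ for all $f,\varphi,d$ as above and all $m,r_1\in\mathbb N$, $m\geq 1$, with $\lambda,\varphi,\mu\ge 1/m$, $\mu\le m$ and $$\left|\frac{n(r)}{r^\rho}-\mu\right|\le\frac1{\kappa(m)+1}\qquad\text{for all real } r\ge r_1 .$$ -/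

import Mathlib

open Filter Topology

noncomputable section

namespace AlgPts

/-! ### Heights of algebraic numbers -/

/-- The minimal polynomial over `ℤ` of an algebraic number `x`: the primitive integer polynomial
(unique up to sign) that is proportional to the minimal polynomial of `x` over `ℚ`. -/
def intMinpoly (x : ℂ) : Polynomial ℤ :=
  (IsLocalization.integerNormalization (nonZeroDivisors ℤ) (minpoly ℚ x)).primPart

theorem intMinpoly_isPrimitive (x : ℂ) : (intMinpoly x).IsPrimitive :=
  Polynomial.isPrimitive_primPart _

theorem aeval_intMinpoly (x : ℂ) (hx : IsAlgebraic ℚ x) :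
    Polynomial.aeval x (intMinpoly x) = 0 := by
  have h0 : IsLocalization.integerNormalization (nonZeroDivisors ℤ) (minpoly ℚ x) ≠ 0 := by
    rw [Ne, IsFractionRing.integerNormalization_eq_zero_iff]
    exact minpoly.ne_zero hx.isIntegral
  exact Polynomial.aeval_primPart_eq_zero h0
    (IsLocalization.integerNormalization_aeval_eq_zero _ _ (minpoly.aeval ℚ x))

/-- The absolute multiplicative height `H(x) = M(x) ^ (1 / deg x)` of an algebraic number `x`,
where `M(x)` is the Mahler measure of the minimal polynomial of `x` over `ℤ`. -/
def height (x : ℂ) : ℝ :=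
  ((intMinpoly x).map (Int.castRingHom ℂ)).mahlerMeasure ^
    (1 / ((intMinpoly x).natDegree : ℝ))

/-- `H(x, y) = max (H(x), H(y))`. -/
def height₂ (x y : ℂ) : ℝ := max (height x) (height y)

/-- `[ℚ(x, y) : ℚ] ≤ d`. The degree is the cardinal `Module.rank`, so the condition fails when the
extension is infinite. -/
def DegreeLE (d : ℕ) (x y : ℂ) : Prop :=
  Module.rank ℚ (IntermediateField.adjoin ℚ ({x, y} : Set ℂ)) ≤ (d : Cardinal)

/-! ### Growth of entire functions -/

/-- The maximum modulus `M(r, f)` on the circle `|z| = r`. -/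
def maxModulus (f : ℂ → ℂ) (r : ℝ) : ℝ :=
  sSup ((fun z => ‖f z‖) '' Metric.sphere (0 : ℂ) r)

/-- The order, `limsup` of `log log M(r, f) / log r` as `r → ∞`, an extended real. -/
def order (f : ℂ → ℂ) : EReal :=
  limsup (fun r : ℝ => ((Real.log (Real.log (maxModulus f r)) / Real.log r : ℝ) : EReal)) atTop

/-- The lower order, `liminf` of `log log M(r, f) / log r` as `r → ∞`, an extended real. -/
def lowerOrder (f : ℂ → ℂ) : EReal :=
  liminf (fun r : ℝ => ((Real.log (Real.log (maxModulus f r)) / Real.log r : ℝ) : EReal)) atTop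

/-! ### The functions under consideration -/

/-- The canonical product `f(z) = ∏ (1 - z / aₙ)`. -/
def canonicalProduct (a : ℕ → ℝ) (z : ℂ) : ℂ := ∏' n, (1 - z / (a n : ℂ))

/-- If `∑ 1 / aₙ` converges then the product does converge to `canonicalProduct a z`. -/
theorem hasProd_canonicalProduct (a : ℕ → ℝ) (h1 : ∀ n, 1 ≤ a n)
    (hs : Summable fun n => 1 / a n) (z : ℂ) :
    HasProd (fun n => 1 - z / (a n : ℂ)) (canonicalProduct a z) := by
  refine Multipliable.hasProd ?_
  have h : Summable fun n => ‖-(z / (a n : ℂ))‖ := by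
    refine (hs.mul_left ‖z‖).congr fun n => ?_
    have : 0 < a n := lt_of_lt_of_le one_pos (h1 n)
    rw [norm_neg, norm_div, Complex.norm_real, Real.norm_of_nonneg this.le]
    ring
  simpa [sub_eq_add_neg] using multipliable_one_add_of_summable h

/-- `n(r)`: the number of indices `k` with `aₖ < r`. -/
def zeroCount (a : ℕ → ℝ) (r : ℝ) : ℕ := {k : ℕ | a k < r}.ncard

/-- The standing assumptions: `1 ≤ a₀ ≤ a₁ ≤ …` with `∑ 1 / aₙ < ∞`, the canonical product with
zeros `aₙ` has lower order `lam` and order `rho` with `0 < lam ≤ rho ≤ 1 / 2`, and `n(r) / r ^ rho`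
tends to a limit `mu` in `(0, ∞)`. -/
structure Admissible (a : ℕ → ℝ) (lam rho mu : ℝ) : Prop where
  monotone : Monotone a
  one_le : ∀ n, 1 ≤ a n
  summable : Summable fun n => 1 / a n
  lowerOrder_eq : lowerOrder (canonicalProduct a) = (lam : EReal)
  order_eq : order (canonicalProduct a) = (rho : EReal)
  lam_pos : 0 < lam
  lam_le_rho : lam ≤ rho
  rho_le_half : rho ≤ 1 / 2
  density : Tendsto (fun r : ℝ => (zeroCount a r : ℝ) / r ^ rho) atTop (𝓝 mu)
  mu_pos : 0 < mu

/-- The closed sector `S_φ = {z : -φ ≤ arg z ≤ φ}`, with vertex `0` included. -/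
def sector (phi : ℝ) : Set ℂ := {z | -phi ≤ z.arg ∧ z.arg ≤ phi}

/-- The complex numbers `z` outside the sector with `[ℚ(z, f(z)) : ℚ] ≤ d` and
`H(z, f(z)) ≤ H`. -/
def algPoints (f : ℂ → ℂ) (phi : ℝ) (d : ℕ) (H : ℝ) : Set ℂ :=
  {z | z ∉ sector phi ∧ DegreeLE d z (f z) ∧ height₂ z (f z) ≤ H}

/-- The exponent `2α(γ + 1) / ρ` with `α = 1 + ρ`, `β = λ / 2`, `γ = (2α + ρ) / (βρ)`. -/
def expo (lam rho : ℝ) : ℝ :=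
  let α : ℝ := 1 + rho
  let β : ℝ := lam / 2
  let γ : ℝ := (2 * α + rho) / (β * rho)
  2 * α * (γ + 1) / rho

/-- For all `H > e` there are at most `C (log H) ^ (2α(γ + 1) / ρ)` of these numbers `z`. -/
def CountBound (a : ℕ → ℝ) (lam rho phi : ℝ) (d : ℕ) (C : ℝ) : Prop :=
  ∀ H : ℝ, Real.exp 1 < H →
    (algPoints (canonicalProduct a) phi d H).Finite ∧
      ((algPoints (canonicalProduct a) phi d H).ncard : ℝ) ≤ C * Real.log H ^ expo lam rho

end AlgPts

end

noncomputable section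

/-! ### Mahler measure and heights -/

namespace AlgPts

/-! The proof joins a growth estimate for `f` outside the sector to the auxiliary-polynomial method
of transcendence theory.

Growth. Write `r = ‖z‖` and let `c` satisfy `z.re ≤ -c * r`. Termwise comparison and summation by
parts give `log |f(z)| ≥ ∫ n(rt) K_c(t) dt/t`, where `K_c` is `kern c`, and the same integral with
`c = 1` bounds `log |f|` from above. Replacing `n(s)` by `μ s^ρ` leaves the main term `μ r^ρ ∫ t^ρ
K_c(t) dt/t`. It is positive because `ρ ≤ 1/2`: for `ρ = 1/2` the integral is computed exactly, and
smaller exponents only favour the region where the kernel is positive. The error in the density is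
absorbed once the precision is fine enough in terms of the distance of `c` from `-1`. Hence, off the
sector, `log |f(z)|` is at least a multiple of `r^ρ` minus a multiple of `r^(ρ/2)`
(`rpow_le_of_log_norm_le`).

Localisation. A counted point has `|f(z)| ≤ H^d`, so by the lower bound it lies in a disc whose
radius `R` is a power of `log H`. This is why the unbounded region causes no difficulty.

Counting. A pigeonhole on Taylor coefficients yields a nonzero integer polynomial `P(x, y)` of
controlled degree and coefficients such that `P(z, f(z))` is tiny on that disc
(`exists_int_combination_small`). The Liouville inequality (`liouville`) then forces `P(z, f(z)) =
0` at every counted point. To count the zeros, Jensen's argument (`four_pow_card_zeros_le`) needs a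
centre where the function is at least `1` in modulus. It is found at a negative integer `-r`: the
leading coefficient of `P` in `y` takes a nonzero integer value there, and `|f(-r)|` is so large
that the leading term dominates.

With `ℓ = ⌈log H⌉` the degree of `P` is of order `ℓ^2` and the logarithm of its maximum on the
Jensen circle of order `ℓ^10`, so there are `O(ℓ^10)` points. The exponent in the theorem is larger
than `10`. All constants are explicit polynomials in natural number data, which gives effectiveness.
-/

theorem natDegree_intMinpoly (x : ℂ) : (intMinpoly x).natDegree = (minpoly ℚ x).natDegree := by
  rw [intMinpoly, Polynomial.natDegree_primPart]
  obtain ⟨b, hb, h⟩ := IsLocalization.integerNormalization_spec (nonZeroDivisors ℤ) (minpoly ℚ x)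
  rw [← Polynomial.natDegree_map_eq_of_injective (RingHom.injective_int (algebraMap ℤ ℚ)), h,
    ← algebraMap_smul ℚ b, Polynomial.natDegree_smul]
  simpa using nonZeroDivisors.ne_zero hb

theorem mahlerMeasure_intMinpoly_le {x : ℂ} (hx : IsAlgebraic ℚ x) {d : ℕ} {H : ℝ}
    (hd : (minpoly ℚ x).natDegree ≤ d) (hH : 1 ≤ H) (h : height x ≤ H) :
    ((intMinpoly x).map (Int.castRingHom ℂ)).mahlerMeasure ≤ H ^ d := by
  set M := ((intMinpoly x).map (Int.castRingHom ℂ)).mahlerMeasure with hM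
  have hM0 : 0 ≤ M := Polynomial.mahlerMeasure_nonneg _
  have hk : 0 < (intMinpoly x).natDegree := by
    rw [natDegree_intMinpoly]; exact minpoly.natDegree_pos hx.isIntegral
  have h1 : M = height x ^ (intMinpoly x).natDegree := by
    rw [height, ← hM, ← Real.rpow_natCast, ← Real.rpow_mul hM0, one_div_mul_cancel, Real.rpow_one]
    exact_mod_cast hk.ne'
  have h0 : 0 ≤ height x := Real.rpow_nonneg hM0 _
  rw [h1]
  calc height x ^ (intMinpoly x).natDegree ≤ H ^ (intMinpoly x).natDegree := by gcongr
    _ ≤ H ^ d := by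
      apply pow_le_pow_right₀ hH
      rw [natDegree_intMinpoly]; exact hd

theorem norm_leadingCoeff_intMinpoly_le (x : ℂ) :
    ‖((intMinpoly x).leadingCoeff : ℂ)‖ ≤
      ((intMinpoly x).map (Int.castRingHom ℂ)).mahlerMeasure := by
  have := Polynomial.leadingCoeff_le_mahlerMeasure ((intMinpoly x).map (Int.castRingHom ℂ))
  rwa [Polynomial.leadingCoeff_map_of_injective (RingHom.injective_int _)] at this

/-- The leading coefficient is a nonzero integer and every factor `max 1 ‖a‖` is at least `1`, so a
single root is bounded by the whole product. It applies to every conjugate, since all are roots of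
the same polynomial. -/
theorem norm_root_le_mahlerMeasure {p : Polynomial ℤ} (hp : p ≠ 0) {w : ℂ}
    (hw : Polynomial.aeval w p = 0) :
    ‖w‖ ≤ (p.map (Int.castRingHom ℂ)).mahlerMeasure := by
  set q := p.map (Int.castRingHom ℂ) with hq
  have hinj : Function.Injective (Int.castRingHom ℂ) := RingHom.injective_int _
  have hq0 : q ≠ 0 := (Polynomial.map_ne_zero_iff hinj).2 hp
  have hlead : 1 ≤ ‖q.leadingCoeff‖ := by
    rw [hq, Polynomial.leadingCoeff_map_of_injective hinj]
    have : p.leadingCoeff ≠ 0 := Polynomial.leadingCoeff_ne_zero.2 hp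
    simp only [eq_intCast, Complex.norm_intCast]
    exact_mod_cast Int.one_le_abs this
  have hroot : w ∈ q.roots := by
    rw [Polynomial.mem_roots hq0, Polynomial.IsRoot, hq, Polynomial.eval_map]
    simpa [Polynomial.aeval_def] using hw
  have h1 : max 1 ‖w‖ ≤ (q.roots.map fun a => max 1 ‖a‖).prod :=
    Multiset.mem_le_prod_of_one_le (f := fun a => max 1 ‖a‖) (fun a => le_max_left 1 ‖a‖) hroot
  rw [Polynomial.mahlerMeasure_eq_leadingCoeff_mul_prod_roots]
  have h0 : 0 ≤ (q.roots.map fun a => max 1 ‖a‖).prod := le_trans (by positivity) h1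
  calc ‖w‖ ≤ max 1 ‖w‖ := le_max_right _ _
    _ ≤ 1 * (q.roots.map fun a => max 1 ‖a‖).prod := by rw [one_mul]; exact h1
    _ ≤ _ := by gcongr

/-! ### Values of integer polynomials at algebraic points and the Liouville inequality -/

/-- The value at `(x, y)` of the polynomial of degree less than `T` in each variable with
coefficients `c`. -/
def biEval {R : Type*} [CommRing R] (T : ℕ) (c : ℕ → ℕ → ℤ) (x y : R) : R :=
  ∑ i ∈ Finset.range T, ∑ j ∈ Finset.range T, (c i j : R) * x ^ i * y ^ j

theorem map_biEval {R S F : Type*} [CommRing R] [CommRing S] [FunLike F R S] [RingHomClass F R S]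
    (φ : F) (T : ℕ) (c : ℕ → ℕ → ℤ) (x y : R) :
    φ (biEval T c x y) = biEval T c (φ x) (φ y) := by
  simp [biEval, map_sum]

theorem norm_biEval_le {T : ℕ} {c : ℕ → ℕ → ℤ} {B X Y : ℝ} (hc : ∀ i j, |(c i j : ℝ)| ≤ B)
    (hX : 1 ≤ X) (hY : 1 ≤ Y) {x y : ℂ} (hx : ‖x‖ ≤ X) (hy : ‖y‖ ≤ Y) :
    ‖biEval T c x y‖ ≤ (T : ℝ) ^ 2 * B * X ^ T * Y ^ T := by
  have hB : 0 ≤ B := (abs_nonneg _).trans (hc 0 0)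
  have : ∀ i ∈ Finset.range T, ‖∑ j ∈ Finset.range T, (c i j : ℂ) * x ^ i * y ^ j‖ ≤
      T * (B * X ^ T * Y ^ T) := by
    intro i hi
    have : ∀ j ∈ Finset.range T, ‖(c i j : ℂ) * x ^ i * y ^ j‖ ≤ B * X ^ T * Y ^ T := by
      intro j hj
      rw [norm_mul, norm_mul, norm_pow, norm_pow, Complex.norm_intCast]
      have h1 : ‖x‖ ^ i ≤ X ^ T := (pow_le_pow_left₀ (norm_nonneg _) hx i).trans
        (pow_le_pow_right₀ hX (Finset.mem_range.1 hi).le)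
      have h2 : ‖y‖ ^ j ≤ Y ^ T := (pow_le_pow_left₀ (norm_nonneg _) hy j).trans
        (pow_le_pow_right₀ hY (Finset.mem_range.1 hj).le)
      have := hc i j
      gcongr
    refine (norm_sum_le_of_le _ this).trans ?_
    simp
  refine (norm_sum_le_of_le _ this).trans ?_
  simp only [Finset.sum_const, Finset.card_range, nsmul_eq_mul]
  apply le_of_eq; ring

/-- Each monomial has degree below `T` in each variable, so `a ^ T * b ^ T` supplies a denominator
for every power of `x` and `y`. -/
theorem biEval_isIntegral {R : Type*} [CommRing R] {T : ℕ} (c : ℕ → ℕ → ℤ) {x y : R} {a b : ℤ}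
    (hx : IsIntegral ℤ ((a : R) * x)) (hy : IsIntegral ℤ ((b : R) * y)) :
    IsIntegral ℤ ((a : R) ^ T * (b : R) ^ T * biEval T c x y) := by
  have key : (a : R) ^ T * (b : R) ^ T * biEval T c x y =
      ∑ i ∈ Finset.range T, ∑ j ∈ Finset.range T,
        ((c i j * a ^ (T - i) * b ^ (T - j) : ℤ) : R) * ((a * x) ^ i * (b * y) ^ j) := by
    rw [biEval, Finset.mul_sum]
    refine Finset.sum_congr rfl fun i hi => ?_
    rw [Finset.mul_sum]
    refine Finset.sum_congr rfl fun j hj => ?_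
    have h1 : (a : R) ^ T = a ^ (T - i) * a ^ i := by
      rw [← pow_add, Nat.sub_add_cancel (Finset.mem_range.1 hi).le]
    have h2 : (b : R) ^ T = b ^ (T - j) * b ^ j := by
      rw [← pow_add, Nat.sub_add_cancel (Finset.mem_range.1 hj).le]
    rw [h1, h2]; push_cast; ring
  rw [key]
  refine IsIntegral.sum _ fun i _ => IsIntegral.sum _ fun j _ => ?_
  exact (isIntegral_algebraMap (R := ℤ) (A := R)).mul ((hx.pow i).mul (hy.pow j))

theorem one_le_abs_of_isIntegral {q : ℚ} (hq : IsIntegral ℤ q) (h0 : q ≠ 0) : 1 ≤ |q| := by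
  obtain ⟨n, rfl⟩ := IsIntegrallyClosed.isIntegral_iff.1 hq
  have : n ≠ 0 := by rintro rfl; simp at h0
  simpa using (by exact_mod_cast Int.one_le_abs this : (1 : ℚ) ≤ |(n : ℚ)|)

theorem DegreeLE.finiteDimensional {d : ℕ} {z y : ℂ} (hd : DegreeLE d z y) :
    FiniteDimensional ℚ (IntermediateField.adjoin ℚ ({z, y} : Set ℂ)) := by
  rw [FiniteDimensional, ← Module.rank_lt_aleph0_iff]
  exact lt_of_le_of_lt hd Cardinal.natCast_lt_aleph0

theorem DegreeLE.isAlgebraic_and_natDegree_le {d : ℕ} {z y : ℂ} (hd : DegreeLE d z y) {x : ℂ}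
    (hx : x ∈ IntermediateField.adjoin ℚ ({z, y} : Set ℂ)) :
    IsAlgebraic ℚ x ∧ (minpoly ℚ x).natDegree ≤ d := by
  have := hd.finiteDimensional
  set K := IntermediateField.adjoin ℚ ({z, y} : Set ℂ)
  have hrank : Module.finrank ℚ K ≤ d := by
    have : (Module.finrank ℚ K : Cardinal) ≤ d := by rw [Module.finrank_eq_rank]; exact hd
    exact_mod_cast this
  have halg : IsAlgebraic ℚ (⟨x, hx⟩ : K) := Algebra.IsAlgebraic.isAlgebraic _
  refine ⟨halg.algebraMap (A := ℂ), ?_⟩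
  have h1 : minpoly ℚ x = minpoly ℚ (⟨x, hx⟩ : K) :=
    minpoly.algebraMap_eq (algebraMap K ℂ).injective (⟨x, hx⟩ : K)
  rw [h1]; exact (minpoly.natDegree_le _).trans hrank

theorem DegreeLE.norm_right_le {d : ℕ} {z y : ℂ} (hd : DegreeLE d z y) {H : ℝ} (hH : 1 ≤ H)
    (hy : height y ≤ H) : ‖y‖ ≤ H ^ d := by
  obtain ⟨halg, hdeg⟩ := hd.isAlgebraic_and_natDegree_le
    (IntermediateField.subset_adjoin ℚ ({z, y} : Set ℂ) (Set.mem_insert_of_mem _ rfl))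
  exact (norm_root_le_mahlerMeasure (intMinpoly_isPrimitive _).ne_zero
    (aeval_intMinpoly _ halg)).trans (mahlerMeasure_intMinpoly_le halg hdeg hH hy)

/-- Used for the norm as a product over embeddings: one conjugate carries the small factor `a`, the
others get the crude bound `E`. -/
theorem prod_univ_le_pow_mul {ι : Type*} [Fintype ι] {g : ι → ℝ} {E a : ℝ} {d : ℕ} (i₀ : ι)
    (h0 : ∀ i, 0 ≤ g i) (hE : ∀ i, g i ≤ E) (hi₀ : g i₀ ≤ E * a) (hcard : Fintype.card ι ≤ d)
    (hE1 : 1 ≤ E) (ha : 0 ≤ a) : ∏ i, g i ≤ E ^ d * a := by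
  classical
  rw [← Finset.mul_prod_erase Finset.univ g (Finset.mem_univ i₀)]
  have h2 : ∏ i ∈ Finset.univ.erase i₀, g i ≤ E ^ (Finset.univ.erase i₀).card := by
    rw [← Finset.prod_const]
    exact Finset.prod_le_prod (fun i _ => h0 i) fun i _ => hE i
  have h3 : (Finset.univ.erase i₀).card + 1 ≤ d := by
    rwa [Finset.card_erase_add_one (Finset.mem_univ _), Finset.card_univ]
  calc _ ≤ (E * a) * E ^ (Finset.univ.erase i₀).card :=
        mul_le_mul hi₀ h2 (Finset.prod_nonneg fun i _ => h0 i) (by positivity)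
    _ = E ^ ((Finset.univ.erase i₀).card + 1) * a := by ring
    _ ≤ E ^ d * a := by gcongr

/-- A Liouville-type lower bound for a nonzero polynomial value at an algebraic point. -/
theorem liouville {z y : ℂ} {d T : ℕ} {B H : ℝ} {c : ℕ → ℕ → ℤ} (hd : DegreeLE d z y)
    (hH : 1 ≤ H) (hh : height₂ z y ≤ H) (hT : 1 ≤ T) (hB1 : 1 ≤ B)
    (hB : ∀ i j, |(c i j : ℝ)| ≤ B) (hne : biEval T c z y ≠ 0) :
    1 ≤ ((T : ℝ) ^ 2 * B * H ^ (4 * d * T)) ^ d * ‖biEval T c z y‖ := by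
  set K := IntermediateField.adjoin ℚ ({z, y} : Set ℂ) with hK
  have hfin : FiniteDimensional ℚ K := hd.finiteDimensional
  have hrank : Module.finrank ℚ K ≤ d := by
    have : (Module.finrank ℚ K : Cardinal) ≤ d := by rw [Module.finrank_eq_rank]; exact hd
    exact_mod_cast this
  have hzK : z ∈ K := IntermediateField.subset_adjoin _ _ (by simp)
  have hyK : y ∈ K := IntermediateField.subset_adjoin _ _ (by simp)
  have hT0 : (1 : ℝ) ≤ T := by exact_mod_cast hT
  have conj : ∀ x : K, height (x : ℂ) ≤ H →
      ‖((intMinpoly (x : ℂ)).leadingCoeff : ℂ)‖ ≤ H ^ d ∧ (intMinpoly (x : ℂ)).leadingCoeff ≠ 0 ∧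
      IsIntegral ℤ (((intMinpoly (x : ℂ)).leadingCoeff : K) * x) ∧
      ∀ σ : K →ₐ[ℚ] ℂ, ‖σ x‖ ≤ H ^ d := by
    intro x hx
    obtain ⟨halg, hdeg⟩ := hd.isAlgebraic_and_natDegree_le x.2
    have hM := mahlerMeasure_intMinpoly_le halg hdeg hH hx
    have hp0 : intMinpoly (x : ℂ) ≠ 0 := (intMinpoly_isPrimitive _).ne_zero
    have hrootC := aeval_intMinpoly (x : ℂ) halg
    have hrootK : Polynomial.aeval x (intMinpoly (x : ℂ)) = 0 := by
      apply (algebraMap K ℂ).injective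
      rw [map_zero, ← Polynomial.aeval_algebraMap_apply]; exact hrootC
    refine ⟨(norm_leadingCoeff_intMinpoly_le _).trans hM, Polynomial.leadingCoeff_ne_zero.2 hp0,
      ?_, fun σ => ?_⟩
    · have := isIntegral_leadingCoeff_smul _ x hrootK
      simpa [zsmul_eq_mul] using this
    · refine (norm_root_le_mahlerMeasure hp0 ?_).trans hM
      have := Polynomial.aeval_algHom_apply (σ.restrictScalars ℤ) x (intMinpoly (x : ℂ))
      rw [hrootK, map_zero] at this
      exact this
  obtain ⟨ha, ha0, haI, haσ⟩ := conj ⟨z, hzK⟩ ((le_max_left _ _).trans hh)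
  obtain ⟨hb, hb0, hbI, hbσ⟩ := conj ⟨y, hyK⟩ ((le_max_right _ _).trans hh)
  set a := (intMinpoly z).leadingCoeff
  set b := (intMinpoly y).leadingCoeff
  set x : K := ⟨z, hzK⟩
  set w : K := ⟨y, hyK⟩
  have hI := biEval_isIntegral (T := T) c haI hbI
  -- Clearing denominators makes `ξ` an algebraic integer, so its norm is a nonzero rational
  -- integer. The inclusion `K.val` is the embedding at which `ξ` is a multiple of the value to be
  -- bounded below.
  set ξ : K := (a : K) ^ T * (b : K) ^ T * biEval T c x w with hξ
  have hσξ : ∀ σ : K →ₐ[ℚ] ℂ, σ ξ = (a : ℂ) ^ T * (b : ℂ) ^ T * biEval T c (σ x) (σ w) := by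
    intro σ; rw [hξ, map_mul, map_mul, map_pow, map_pow, map_biEval, map_intCast, map_intCast]
  have hξ0 : ξ ≠ 0 := by
    rw [hξ]
    refine mul_ne_zero (mul_ne_zero (pow_ne_zero _ ?_) (pow_ne_zero _ ?_)) ?_
    · exact_mod_cast ha0
    · exact_mod_cast hb0
    · intro h
      apply hne
      have := congrArg K.val h
      rw [map_biEval, map_zero] at this
      exact this
  have hN : 1 ≤ |Algebra.norm ℚ ξ| :=
    one_le_abs_of_isIntegral (Algebra.isIntegral_norm ℚ hI) (Algebra.norm_ne_zero_iff.2 hξ0)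
  have hprod := Algebra.norm_eq_prod_embeddings ℚ ℂ ξ
  set E : ℝ := (T : ℝ) ^ 2 * B * H ^ (4 * d * T) with hE
  have hHd : 1 ≤ H ^ d := one_le_pow₀ hH
  have hHp : ∀ n, 1 ≤ H ^ n := fun n => one_le_pow₀ hH
  have hab : ‖(a : ℂ) ^ T * (b : ℂ) ^ T‖ ≤ H ^ (2 * d * T) := by
    rw [norm_mul, norm_pow, norm_pow]
    calc _ ≤ (H ^ d) ^ T * (H ^ d) ^ T := by gcongr
      _ = _ := by rw [← pow_mul, ← pow_add]; congr 1; ring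
  have hTB : 1 ≤ (T : ℝ) ^ 2 * B := one_le_mul_of_one_le_of_one_le (one_le_pow₀ hT0) hB1
  have hE1 : 1 ≤ E := one_le_mul_of_one_le_of_one_le hTB (hHp _)
  have hσle : ∀ σ : K →ₐ[ℚ] ℂ, ‖σ ξ‖ ≤ E := by
    intro σ
    rw [hσξ, norm_mul]
    calc _ ≤ H ^ (2 * d * T) * ((T : ℝ) ^ 2 * B * (H ^ d) ^ T * (H ^ d) ^ T) := by
          gcongr
          exact norm_biEval_le hB hHd hHd (haσ σ) (hbσ σ)
      _ = E := by
          have : 4 * d * T = 2 * d * T + d * T + d * T := by ring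
          rw [hE, this, pow_add, pow_add, pow_mul H d T]; ring
  -- The exponent `4 * d * T` is made of `2 * d * T` for the two leading coefficients and `d * T`
  -- for each coordinate; at the inclusion only the first part is needed.
  have hσ0 : ‖K.val ξ‖ ≤ E * ‖biEval T c z y‖ := by
    rw [show K.val ξ = _ from hσξ K.val, norm_mul]
    gcongr
    · refine hab.trans ?_
      calc H ^ (2 * d * T) ≤ H ^ (4 * d * T) := pow_le_pow_right₀ hH (by gcongr; norm_num)
        _ ≤ E := le_mul_of_one_le_left (by positivity) hTB
    · exact le_rfl
  have h1 : (1 : ℝ) ≤ ∏ σ : K →ₐ[ℚ] ℂ, ‖σ ξ‖ := by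
    rw [← norm_prod, ← hprod]
    have : ‖algebraMap ℚ ℂ (Algebra.norm ℚ ξ)‖ = ((|Algebra.norm ℚ ξ| : ℚ) : ℝ) := by
      simp
    rw [this]; exact_mod_cast hN
  exact h1.trans (prod_univ_le_pow_mul K.val (fun _ => norm_nonneg _) hσle hσ0
    (by rw [AlgHom.card]; exact hrank) hE1 (norm_nonneg _))

/-! ### Counting zeros in a disc -/

theorem exists_eq_prod_sub_mul {F : ℂ → ℂ} (hF : Differentiable ℂ F) (S : Finset ℂ)
    (h : ∀ z ∈ S, F z = 0) :
    ∃ G : ℂ → ℂ, Differentiable ℂ G ∧ ∀ z, F z = (∏ w ∈ S, (z - w)) * G z := by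
  classical
  induction S using Finset.induction_on with
  | empty => exact ⟨F, hF, by simp⟩
  | insert a S ha ih =>
    obtain ⟨G, hG, hFG⟩ := ih fun z hz => h z (Finset.mem_insert_of_mem hz)
    have hGa : G a = 0 := by
      have := h a (Finset.mem_insert_self a S)
      rw [hFG] at this
      refine (mul_eq_zero.1 this).resolve_left (Finset.prod_ne_zero_iff.2 fun w hw => ?_)
      rw [sub_ne_zero]; rintro rfl; exact ha hw
    refine ⟨dslope G a, ?_, fun z => ?_⟩
    · rw [← differentiableOn_univ] at hG ⊢
      exact (Complex.differentiableOn_dslope Filter.univ_mem).2 hG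
    · have := sub_smul_dslope G a z
      rw [hGa, sub_zero, smul_eq_mul] at this
      rw [Finset.prod_insert ha, hFG, ← this]; ring

/-- A Jensen-type bound for the number of zeros in a disc. -/
theorem four_pow_card_zeros_le {F : ℂ → ℂ} (hF : Differentiable ℂ F) {c : ℂ} {s M : ℝ}
    (hs : 0 < s) (hM : ∀ z, ‖z - c‖ = 5 * s → ‖F z‖ ≤ M) (hc : 1 ≤ ‖F c‖) (S : Finset ℂ)
    (hS : ∀ z ∈ S, ‖z - c‖ ≤ s ∧ F z = 0) : (4 : ℝ) ^ S.card ≤ M := by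
  obtain ⟨G, hG, hFG⟩ := exists_eq_prod_sub_mul hF S fun z hz => (hS z hz).2
  have h4 : (0 : ℝ) < (4 * s) ^ S.card := by positivity
  -- On the circle of radius `5 * s` each factor `z - w` has modulus at least `4 * s`, whereas at
  -- the centre it is at most `s`. The maximum principle for the quotient `G` turns this ratio into
  -- a gain of `4` per zero.
  have hGc : ‖G c‖ ≤ M / (4 * s) ^ S.card := by
    refine Complex.norm_le_of_forall_mem_frontier_norm_le (U := Metric.ball c (5 * s))
      Metric.isBounded_ball hG.diffContOnCl (fun z hz => ?_)
      (subset_closure (Metric.mem_ball_self (by positivity)))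
    rw [frontier_ball c (by positivity), mem_sphere_iff_norm] at hz
    rw [le_div_iff₀ h4]
    have h1 := hM z hz
    rw [hFG, norm_mul, norm_prod] at h1
    refine le_trans ?_ h1
    rw [mul_comm]
    gcongr
    rw [← Finset.prod_const]
    refine Finset.prod_le_prod (fun _ _ => by positivity) fun w hw => ?_
    have := norm_sub_norm_le (z - c) (w - c)
    rw [sub_sub_sub_cancel_right] at this
    linarith [(hS w hw).1]
  have h2 : ∏ w ∈ S, ‖c - w‖ ≤ s ^ S.card := by
    rw [← Finset.prod_const]
    refine Finset.prod_le_prod (fun _ _ => by positivity) fun w hw => ?_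
    rw [norm_sub_rev]; exact (hS w hw).1
  have h3 : 1 ≤ s ^ S.card * (M / (4 * s) ^ S.card) := by
    refine hc.trans ?_
    rw [hFG, norm_mul, norm_prod]
    gcongr
  rw [mul_pow] at h3
  have h5 : s ^ S.card * (M / (4 ^ S.card * s ^ S.card)) = M / 4 ^ S.card := by
    field_simp
  rw [h5, le_div_iff₀ (by positivity)] at h3
  simpa using h3

/-! ### The auxiliary polynomial -/

theorem norm_taylorCoeff_le {F : ℂ → ℂ} (hF : Differentiable ℂ F) {R M : ℝ} (hR : 0 < R)
    (hM : ∀ z, ‖z‖ = 4 * R → ‖F z‖ ≤ M) (k : ℕ) :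
    R ^ k * ‖iteratedDeriv k F 0‖ / k.factorial ≤ M * (1 / 4) ^ k := by
  have := Complex.norm_iteratedDeriv_le_of_forall_mem_sphere_norm_le k (c := 0) (R := 4 * R)
    (C := M) (by positivity) hF.diffContOnCl (fun z hz => hM z (by simpa using hz))
  rw [div_le_iff₀ (by positivity)]
  calc R ^ k * ‖iteratedDeriv k F 0‖ ≤ R ^ k * (k.factorial * M / (4 * R) ^ k) := by gcongr
    _ = _ := by rw [mul_pow, one_div, inv_pow]; field_simp

/-- The first `N` Taylor terms are small by assumption. The Cauchy estimates on the circle of radius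
`4 * R` bound the others by `M * 4⁻ᵏ ≤ M * 2⁻ᴺ * 2⁻ᵏ`, which sums geometrically. -/
theorem norm_le_of_taylorCoeff_small {F : ℂ → ℂ} (hF : Differentiable ℂ F) {R M η : ℝ}
    (hR : 0 < R) (hM : ∀ z, ‖z‖ = 4 * R → ‖F z‖ ≤ M) {N : ℕ}
    (hN : ∀ k < N, R ^ k * ‖iteratedDeriv k F 0‖ / k.factorial ≤ η) {z : ℂ} (hz : ‖z‖ ≤ R) :
    ‖F z‖ ≤ N * η + 2 * M * (1 / 2) ^ N := by
  have hM0 : 0 ≤ M := by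
    have := hM ((4 * R : ℝ) : ℂ) (by rw [Complex.norm_real, Real.norm_of_nonneg (by positivity)])
    exact (norm_nonneg _).trans this
  have hsum := Complex.hasSum_taylorSeries_of_entire hF 0 z
  have hb1 : HasSum (fun k => if k ∈ Finset.range N then η else 0) (∑ k ∈ Finset.range N, η) := by
    have : ∑ k ∈ Finset.range N, η =
        ∑ k ∈ Finset.range N, if k ∈ Finset.range N then η else 0 :=
      Finset.sum_congr rfl fun k hk => by simp [Finset.mem_range.1 hk]
    rw [this]
    exact hasSum_sum_of_ne_finset_zero fun k hk => by simp [Finset.mem_range.not.1 hk]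
  have hb2 := (hasSum_geometric_of_lt_one (r := (1 / 2 : ℝ)) (by norm_num) (by norm_num)).mul_left
    (M * (1 / 2) ^ N)
  have hb := hb1.add hb2
  have hle := tsum_of_norm_bounded hb (f := fun n => ((n.factorial : ℂ)⁻¹ • (z - 0) ^ n •
    iteratedDeriv n F 0)) fun k => ?_
  · rw [hsum.tsum_eq] at hle
    refine hle.trans (le_of_eq ?_)
    simp; ring
  · have h1 : ‖(k.factorial : ℂ)⁻¹ • (z - 0) ^ k • iteratedDeriv k F 0‖ ≤
        R ^ k * ‖iteratedDeriv k F 0‖ / k.factorial := by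
      rw [norm_smul, norm_smul, norm_inv, norm_pow, sub_zero, Complex.norm_natCast, div_eq_inv_mul]
      gcongr
    refine h1.trans ?_
    by_cases hk : k < N
    · have : 0 ≤ M * (1 / 2) ^ N * (1 / 2) ^ k := by positivity
      simp only [Finset.mem_range, hk, if_true]
      linarith [hN k hk]
    · simp only [Finset.mem_range, hk, if_false, zero_add]
      refine (norm_taylorCoeff_le hF hR hM k).trans ?_
      rw [mul_assoc, ← pow_add]
      have : (1 / 4 : ℝ) ^ k = (1 / 2) ^ (k + k) := by
        rw [← two_mul, pow_mul]; norm_num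
      rw [this]
      gcongr ?_ * ?_
      exact pow_le_pow_of_le_one (by norm_num) (by norm_num) (by omega)

/-- Pigeonhole: some nontrivial integer combination of entire functions is small on a disc. -/
theorem exists_int_combination_small {ι : Type*} [Fintype ι] (φ : ι → ℂ → ℂ)
    (hφ : ∀ i, Differentiable ℂ (φ i)) {R M₀ : ℝ} (hR : 0 < R)
    (hM : ∀ i z, ‖z‖ = 4 * R → ‖φ i z‖ ≤ M₀) {N B W : ℕ} {V M : ℝ} (hV : 0 < V)
    (hMM : Fintype.card ι * B * M₀ ≤ M) (hW : V * M ≤ W)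
    (hcard : (2 * W + 1) ^ (2 * N) < (B + 1) ^ Fintype.card ι) :
    ∃ c : ι → ℤ, c ≠ 0 ∧ (∀ i, |c i| ≤ B) ∧
      ∀ z, ‖z‖ ≤ R → ‖∑ i, (c i : ℂ) * φ i z‖ ≤ N * (2 / V) + 2 * M * (1 / 2) ^ N := by
  classical
  let F : (ι → ℤ) → ℂ → ℂ := fun c z => ∑ i, (c i : ℂ) * φ i z
  have hF : ∀ c, Differentiable ℂ (F c) := fun c =>
    Differentiable.fun_sum fun i _ => (hφ i).const_mul _
  have hFM : ∀ c : ι → ℤ, (∀ i, |c i| ≤ B) → ∀ z, ‖z‖ = 4 * R → ‖F c z‖ ≤ M := by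
    intro c hc z hz
    refine le_trans (norm_sum_le_of_le Finset.univ (n := fun _ => (B : ℝ) * M₀) fun i _ => ?_) ?_
    · rw [norm_mul, Complex.norm_intCast]
      have h1 : |(c i : ℝ)| ≤ B := by exact_mod_cast hc i
      have h2 := hM i z hz
      gcongr
    · simp only [Finset.sum_const, Finset.card_univ, nsmul_eq_mul]
      rwa [← mul_assoc]
  -- Scaled Taylor coefficients: two combinations whose first `N` values of `α` have equal floors in
  -- real and imaginary part differ by one with Taylor terms at most `2 / V`.
  let α : (ι → ℤ) → ℕ → ℂ := fun c k => ((V * (R ^ k / k.factorial) : ℝ) : ℂ) *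
    iteratedDeriv k (F c) 0
  have hα : ∀ c k, ‖α c k‖ = V * (R ^ k * ‖iteratedDeriv k (F c) 0‖ / k.factorial) := by
    intro c k
    rw [norm_mul, Complex.norm_real, Real.norm_of_nonneg (by positivity)]; ring
  have hαle : ∀ c : ι → ℤ, (∀ i, |c i| ≤ B) → ∀ k, ‖α c k‖ ≤ W := by
    intro c hc k
    rw [hα]
    refine le_trans ?_ hW
    have h1 := norm_taylorCoeff_le (hF c) hR (hFM c hc) k
    have hM0 : 0 ≤ M := by
      have := hFM c hc ((4 * R : ℝ) : ℂ)
        (by rw [Complex.norm_real, Real.norm_of_nonneg (by positivity)])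
      exact (norm_nonneg _).trans this
    have h2 : M * (1 / 4) ^ k ≤ M := mul_le_of_le_one_right hM0
      (pow_le_one₀ (by norm_num) (by norm_num))
    gcongr
    exact h1.trans h2
  have hfloor : ∀ x : ℝ, |x| ≤ W → ⌊x⌋ ∈ Finset.Icc (-(W : ℤ)) W := by
    intro x hx
    rw [abs_le] at hx
    rw [Finset.mem_Icc]
    constructor
    · rw [Int.le_floor]; push_cast; exact hx.1
    · have : (⌊x⌋ : ℝ) ≤ W := (Int.floor_le x).trans hx.2
      exact_mod_cast this
  -- Entries are taken in `[0, B]`, so that differences of two vectors are bounded by `B` and not `2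
  -- * B`.
  let D : Finset (ι → ℤ) := Fintype.piFinset fun _ => Finset.Icc 0 (B : ℤ)
  let I : Finset ℤ := Finset.Icc (-(W : ℤ)) W
  let Tg : Finset (Fin N → ℤ × ℤ) := Fintype.piFinset fun _ => I ×ˢ I
  have hD : D.card = (B + 1) ^ Fintype.card ι := by simp [D]
  have hTg : Tg.card = (2 * W + 1) ^ (2 * N) := by
    have : I.card = 2 * W + 1 := by simp [I]; omega
    simp [Tg, this, pow_mul, sq]
  obtain ⟨c, hc, c', hc', hne, heq⟩ := Finset.exists_ne_map_eq_of_card_lt_of_maps_to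
    (s := D) (t := Tg) (by rw [hD, hTg]; exact hcard)
    (f := fun c k => (⌊(α c k).re⌋, ⌊(α c k).im⌋)) (by
      intro c hc
      have hcB : ∀ i, |c i| ≤ B := fun i => by
        have := Finset.mem_Icc.1 (Fintype.mem_piFinset.1 hc i)
        rw [abs_of_nonneg this.1]; exact this.2
      simp only [Tg, Finset.mem_coe, Fintype.mem_piFinset, Finset.mem_product]
      exact fun k => ⟨hfloor _ ((Complex.abs_re_le_norm _).trans (hαle c hcB k)),
        hfloor _ ((Complex.abs_im_le_norm _).trans (hαle c hcB k))⟩)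
  refine ⟨c - c', sub_ne_zero.2 hne, fun i => ?_, fun z hz => ?_⟩
  · have h1 := Finset.mem_Icc.1 (Fintype.mem_piFinset.1 hc i)
    have h2 := Finset.mem_Icc.1 (Fintype.mem_piFinset.1 hc' i)
    rw [Pi.sub_apply, abs_le]; omega
  · have hcB : ∀ i, |(c - c') i| ≤ B := fun i => by
      have h1 := Finset.mem_Icc.1 (Fintype.mem_piFinset.1 hc i)
      have h2 := Finset.mem_Icc.1 (Fintype.mem_piFinset.1 hc' i)
      rw [Pi.sub_apply, abs_le]; omega
    refine norm_le_of_taylorCoeff_small (hF (c - c')) hR (hFM _ hcB)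
      (fun k hk => ?_) hz
    have hsub : F (c - c') = F c - F c' := by
      funext w
      simp only [F, Pi.sub_apply, ← Finset.sum_sub_distrib]
      exact Finset.sum_congr rfl fun i _ => by push_cast; ring
    have hαsub : α (c - c') k = α c k - α c' k := by
      simp only [α, hsub]
      rw [iteratedDeriv_sub (hF c).contDiff.contDiffAt (hF c').contDiff.contDiffAt]; ring
    have hk' := congrFun heq ⟨k, hk⟩
    simp only [Prod.mk.injEq] at hk'
    have h1 := Int.abs_sub_lt_one_of_floor_eq_floor hk'.1
    have h2 := Int.abs_sub_lt_one_of_floor_eq_floor hk'.2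
    have h3 : ‖α (c - c') k‖ ≤ 2 := by
      rw [hαsub]
      refine (Complex.norm_le_abs_re_add_abs_im _).trans ?_
      rw [Complex.sub_re, Complex.sub_im]; linarith
    rw [hα] at h3
    rw [le_div_iff₀ hV]; linarith

theorem natCast_sq_le_four_pow (T : ℕ) : (T : ℝ) ^ 2 ≤ 4 ^ T := by
  have h : (T : ℝ) ≤ 2 ^ T := by exact_mod_cast Nat.lt_two_pow_self.le
  calc (T : ℝ) ^ 2 ≤ (2 ^ T) ^ 2 := by gcongr
    _ = 4 ^ T := by rw [← pow_mul, mul_comm, pow_mul]; norm_num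

/-- The pigeonhole is applied to the monomials `z ^ i * f z ^ j`. Both the Liouville loss and the
gain are powers of `4` with exponent proportional to `X = d ^ 2 * E * T`, and the gain wins, so a
nonzero value at an algebraic point is impossible. -/
theorem exists_auxiliary {f : ℂ → ℂ} (hf : Differentiable ℂ f) {d E T : ℕ} (hd : 1 ≤ d)
    (hE : 1 ≤ E) {R H : ℝ} (hR : 0 < R) (hH : 1 ≤ H) (hHE : H ≤ 4 ^ E) (hRE : 4 * R ≤ 4 ^ E)
    (hfE : ∀ z, ‖z‖ = 4 * R → ‖f z‖ ≤ 4 ^ E) (hT : T = 1200 * d ^ 4 * E) :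
    ∃ c : ℕ → ℕ → ℤ, (∃ i < T, ∃ j < T, c i j ≠ 0) ∧ (∀ i j, |(c i j : ℝ)| ≤ 4 ^ (E * T)) ∧
      ∀ z, ‖z‖ ≤ R → DegreeLE d z (f z) → height₂ z (f z) ≤ H → biEval T c z (f z) = 0 := by
  have hT1 : 1 ≤ T := by
    rw [hT]; exact Nat.mul_pos (Nat.mul_pos (by norm_num) (pow_pos hd 4)) hE
  set X := d ^ 2 * E * T with hX
  have hd2 : d ≤ d ^ 2 := Nat.le_self_pow (by norm_num) d
  have hETX : E * T ≤ X := by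
    rw [hX, mul_assoc]; exact Nat.le_mul_of_pos_left _ (by positivity)
  have hTE : T ≤ E * T := Nat.le_mul_of_pos_left _ hE
  have hX1 : 1 ≤ X := hT1.trans (hTE.trans hETX)
  have hEpow : ∀ k, (1 : ℝ) ≤ 4 ^ k := fun k => one_le_pow₀ (by norm_num)
  obtain ⟨c, hc0, hcB, hsmall⟩ := exists_int_combination_small (ι := Fin T × Fin T)
    (fun p z => z ^ (p.1 : ℕ) * f z ^ (p.2 : ℕ))
    (fun p => (differentiable_id.pow _).mul (hf.pow _)) (M₀ := 4 ^ (2 * E * T)) hR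
    (fun p z hz => by
      rw [norm_mul, norm_pow, norm_pow]
      have h1 : ‖z‖ ≤ 4 ^ E := hz.le.trans hRE
      have h2 := hfE z hz
      calc ‖z‖ ^ (p.1 : ℕ) * ‖f z‖ ^ (p.2 : ℕ) ≤ (4 ^ E) ^ (p.1 : ℕ) * (4 ^ E) ^ (p.2 : ℕ) := by
            gcongr
        _ ≤ (4 ^ E) ^ T * (4 ^ E) ^ T := by
            gcongr <;> first | exact hEpow _ | exact p.1.2.le | exact p.2.2.le
        _ = 4 ^ (2 * E * T) := by rw [← pow_mul, ← pow_add]; congr 1; ring)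
    -- The Liouville factor will be at most `4 ^ (6 * X)`. Against it stand a rounding error of
    -- order `X / 4 ^ (20 * X)` and a Taylor tail `2 * 4 ^ (4 * X) / 4 ^ (12 * X)`; `W = V * M`
    -- bounds the scaled coefficients.
    (N := 24 * X) (B := 4 ^ (E * T)) (W := 4 ^ (24 * X)) (V := 4 ^ (20 * X))
    (M := 4 ^ (4 * X)) (by positivity)
    (by
      have := natCast_sq_le_four_pow T
      simp only [Fintype.card_prod, Fintype.card_fin, Nat.cast_mul, Nat.cast_pow, Nat.cast_ofNat]
      calc (T : ℝ) * T * 4 ^ (E * T) * 4 ^ (2 * E * T)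
          ≤ 4 ^ T * 4 ^ (E * T) * 4 ^ (2 * E * T) := by rw [← sq]; gcongr
        _ = 4 ^ (T + 3 * (E * T)) := by rw [← pow_add, ← pow_add]; congr 1; ring
        _ ≤ 4 ^ (4 * X) := by gcongr; · norm_num
                              · omega)
    (by rw [← pow_add]; push_cast; apply le_of_eq; congr 1; ring)
    (by
      have h1 : 2 * 4 ^ (24 * X) + 1 ≤ 4 ^ (25 * X) := by
        have : 4 ^ (24 * X) * 4 ≤ 4 ^ (25 * X) := by
          rw [← pow_succ]; exact Nat.pow_le_pow_right (by norm_num) (by omega)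
        have := Nat.one_le_pow (24 * X) 4 (by norm_num)
        omega
      -- This identity is the source of `T = 1200 * d ^ 4 * E`: `25 * 48 = 1200`, and one factor `T`
      -- is replaced by its value.
      have h2 : 25 * X * (2 * (24 * X)) = E * T * (T * T) := by
        rw [hX]; nth_rewrite 5 [hT]; ring
      simp only [Fintype.card_prod, Fintype.card_fin]
      calc (2 * 4 ^ (24 * X) + 1) ^ (2 * (24 * X)) ≤ (4 ^ (25 * X)) ^ (2 * (24 * X)) := by gcongr
        _ = (4 ^ (E * T)) ^ (T * T) := by rw [← pow_mul, ← pow_mul, h2]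
        _ < (4 ^ (E * T) + 1) ^ (T * T) := by
            apply Nat.pow_lt_pow_left (Nat.lt_succ_self _)
            positivity)
  let c' : ℕ → ℕ → ℤ := fun i j => if h : i < T ∧ j < T then c (⟨i, h.1⟩, ⟨j, h.2⟩) else 0
  have hc' : ∀ i j : Fin T, c' i j = c (i, j) := fun i j => by simp [c']
  have hc'B : ∀ i j, |(c' i j : ℝ)| ≤ 4 ^ (E * T) := by
    intro i j
    simp only [c']
    split_ifs with h
    · exact_mod_cast hcB (⟨i, h.1⟩, ⟨j, h.2⟩)
    · simp
  have hev : ∀ z w : ℂ, biEval T c' z w = ∑ p, (c p : ℂ) * (z ^ (p.1 : ℕ) * w ^ (p.2 : ℕ)) := by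
    intro z w
    rw [biEval, Fintype.sum_prod_type, Finset.sum_range]
    refine Finset.sum_congr rfl fun i _ => ?_
    rw [Finset.sum_range]
    exact Finset.sum_congr rfl fun j _ => by rw [hc', mul_assoc]
  refine ⟨c', ?_, hc'B, fun z hz hdeg hht => ?_⟩
  · obtain ⟨p, hp⟩ := Function.ne_iff.1 hc0
    exact ⟨p.1, p.1.2, p.2, p.2.2, by rw [hc']; exact hp⟩
  · by_contra hne
    have hl := liouville hdeg hH hht hT1 (hEpow (E * T)) hc'B hne
    have hs := hsmall z hz
    rw [← hev] at hs
    have hL : ((T : ℝ) ^ 2 * 4 ^ (E * T) * H ^ (4 * d * T)) ^ d ≤ 4 ^ (6 * X) := by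
      have := natCast_sq_le_four_pow T
      calc ((T : ℝ) ^ 2 * 4 ^ (E * T) * H ^ (4 * d * T)) ^ d
          ≤ (4 ^ T * 4 ^ (E * T) * (4 ^ E) ^ (4 * d * T)) ^ d := by gcongr
        _ = 4 ^ ((T + E * T + 4 * d * (E * T)) * d) := by
            rw [← pow_mul, ← pow_add, ← pow_add, ← pow_mul]; congr 2; ring
        _ ≤ 4 ^ (6 * X) := by
            refine pow_le_pow_right₀ (by norm_num) ?_
            have h1 : (T + E * T) * d ≤ 2 * (E * T) * d ^ 2 :=
              Nat.mul_le_mul (by omega) hd2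
            have h2 : 4 * d * (E * T) * d = 4 * X := by rw [hX]; ring
            have h3 : 2 * (E * T) * d ^ 2 = 2 * X := by rw [hX]; ring
            rw [add_mul]; omega
    have hfin : (4 : ℝ) ^ (6 * X) * ((24 * X : ℕ) * (2 / 4 ^ (20 * X)) +
        2 * 4 ^ (4 * X) * (1 / 2) ^ (24 * X)) < 1 := by
      have hx : ((X : ℕ) : ℝ) ≤ 4 ^ X := by
        exact_mod_cast (Nat.lt_pow_self (by norm_num)).le
      have h1 : (1 / 2 : ℝ) ^ (24 * X) = 1 / 4 ^ (12 * X) := by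
        rw [one_div_pow]; congr 1
        rw [show 24 * X = 2 * (12 * X) by ring, pow_mul]; norm_num
      have h2 : (4 : ℝ) ^ (20 * X) = 4 ^ (6 * X) * 4 ^ X * 4 ^ (13 * X) := by
        rw [← pow_add, ← pow_add]; congr 1; ring
      have h3 : (4 : ℝ) ^ (12 * X) = 4 ^ (6 * X) * 4 ^ (4 * X) * 4 ^ (2 * X) := by
        rw [← pow_add, ← pow_add]; congr 1; ring
      have h4 : (4 : ℝ) ^ 13 ≤ 4 ^ (13 * X) := pow_le_pow_right₀ (by norm_num) (by omega)
      have h5 : (4 : ℝ) ^ 2 ≤ 4 ^ (2 * X) := pow_le_pow_right₀ (by norm_num) (by omega)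
      have e1 : (4 : ℝ) ^ (6 * X) * ((24 * X : ℕ) * (2 / 4 ^ (20 * X)) +
          2 * 4 ^ (4 * X) * (1 / 2) ^ (24 * X)) =
          48 * (X / 4 ^ X) / 4 ^ (13 * X) + 2 / 4 ^ (2 * X) := by
        rw [h1, h2, h3]; push_cast; field_simp; ring
      rw [e1]
      have e2 : (X : ℝ) / 4 ^ X ≤ 1 := by rw [div_le_one (by positivity)]; exact hx
      have e3 : 48 * ((X : ℝ) / 4 ^ X) / 4 ^ (13 * X) ≤ 48 * 1 / 4 ^ 13 := by gcongr
      have e4 : (2 : ℝ) / 4 ^ (2 * X) ≤ 2 / 4 ^ 2 := by gcongr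
      norm_num at e3 e4 ⊢
      linarith
    refine absurd (hl.trans ?_) (not_le.2 hfin)
    gcongr

/-! ### A centre for Jensen's argument and the count of zeros -/

/-- As a polynomial in `Y` the expression has leading coefficient a nonzero integer, hence of
modulus at least `1`. The remaining coefficients are at most `A ≤ ‖Y‖ - 1`, so the lower terms sum
geometrically to at most `‖Y‖ ^ J - 1`. -/
theorem one_le_norm_biEval {T J : ℕ} {c : ℕ → ℕ → ℤ} (hJ : J < T)
    (htop : ∀ j, J < j → ∀ i < T, c i j = 0) {x : ℤ}
    (hne : ∑ i ∈ Finset.range T, c i J * x ^ i ≠ 0) {A : ℝ}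
    (hA : ∀ j, ‖(∑ i ∈ Finset.range T, (c i j : ℂ) * (x : ℂ) ^ i)‖ ≤ A) {Y : ℂ}
    (hY : 1 + A ≤ ‖Y‖) : 1 ≤ ‖biEval T c (x : ℂ) Y‖ := by
  set p : ℕ → ℂ := fun j => ∑ i ∈ Finset.range T, (c i j : ℂ) * (x : ℂ) ^ i with hp
  have hA0 : 0 ≤ A := (norm_nonneg _).trans (hA 0)
  have h1 : biEval T c (x : ℂ) Y = ∑ j ∈ Finset.range T, p j * Y ^ j := by
    rw [biEval, Finset.sum_comm]
    exact Finset.sum_congr rfl fun j _ => by rw [hp, Finset.sum_mul]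
  have h2 : ∑ j ∈ Finset.range T, p j * Y ^ j = ∑ j ∈ Finset.range (J + 1), p j * Y ^ j := by
    symm
    refine Finset.sum_subset (Finset.range_subset_range.2 hJ) fun j _ hj => ?_
    have : p j = 0 := Finset.sum_eq_zero fun i hi => by
      rw [htop j (by simpa using hj) i (Finset.mem_range.1 hi)]; simp
    rw [this, zero_mul]
  rw [h1, h2, Finset.sum_range_succ, add_comm]
  have h3 : ‖∑ j ∈ Finset.range J, p j * Y ^ j‖ ≤ ‖Y‖ ^ J - 1 := by
    calc ‖∑ j ∈ Finset.range J, p j * Y ^ j‖ ≤ ∑ j ∈ Finset.range J, (‖Y‖ - 1) * ‖Y‖ ^ j := by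
          refine norm_sum_le_of_le _ fun j _ => ?_
          rw [norm_mul, norm_pow]
          gcongr
          linarith [hA j]
      _ = ‖Y‖ ^ J - 1 := by rw [← Finset.mul_sum, mul_comm, geom_sum_mul]
  have h4 : 1 ≤ ‖p J‖ := by
    have : p J = ((∑ i ∈ Finset.range T, c i J * x ^ i : ℤ) : ℂ) := by simp [hp]
    rw [this, Complex.norm_intCast]
    exact_mod_cast Int.one_le_abs hne
  have h5 : ‖Y‖ ^ J ≤ ‖p J * Y ^ J‖ := by
    rw [norm_mul, norm_pow]; exact le_mul_of_one_le_left (by positivity) h4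
  have := norm_sub_le_norm_add (p J * Y ^ J) (∑ j ∈ Finset.range J, p j * Y ^ j)
  linarith

/-- A nonzero polynomial of degree below `T` cannot vanish at all of the `T + 1` integers `-r₀, …,
-(r₀ + T)`. -/
theorem exists_sum_ne_zero {T J : ℕ} {c : ℕ → ℕ → ℤ} {i₀ : ℕ} (hi : i₀ < T) (h : c i₀ J ≠ 0)
    (r₀ : ℕ) : ∃ r, r₀ ≤ r ∧ r ≤ r₀ + T ∧ ∑ i ∈ Finset.range T, c i J * (-(r : ℤ)) ^ i ≠ 0 := by
  by_contra! hcon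
  set P : Polynomial ℤ := ∑ i ∈ Finset.range T, Polynomial.C (c i J) * Polynomial.X ^ i with hP
  have hcoeff : P.coeff i₀ = c i₀ J := by
    simp [hP, Polynomial.coeff_X_pow, hi]
  have hP0 : P ≠ 0 := fun h0 => h (by rw [← hcoeff, h0, Polynomial.coeff_zero])
  have hdeg : P.degree < T := by
    rw [Polynomial.degree_lt_iff_coeff_zero]
    intro n hn
    rw [hP, Polynomial.finsetSum_coeff]
    refine Finset.sum_eq_zero fun i hi => ?_
    have := Finset.mem_range.1 hi
    rw [Polynomial.coeff_C_mul_X_pow, if_neg (by omega)]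
  refine hP0 (Polynomial.eq_zero_of_degree_lt_of_eval_finset_eq_zero
    ((Finset.Icc r₀ (r₀ + T)).image fun r : ℕ => -(r : ℤ)) ?_ ?_)
  · rw [Finset.card_image_of_injective _ (fun a b hab => by simpa using hab), Nat.card_Icc]
    refine hdeg.trans_le ?_
    exact_mod_cast (by omega : T ≤ r₀ + T + 1 - r₀)
  · intro x hx
    obtain ⟨r, hr, rfl⟩ := Finset.mem_image.1 hx
    rw [Finset.mem_Icc] at hr
    have := hcon r hr.1 hr.2
    rw [hP, Polynomial.eval_finsetSum]
    simpa using this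

/-- The counting argument, with explicit parameters. -/
theorem card_points_le {f : ℂ → ℂ} (hf : Differentiable ℂ f) {d E T U r₀ : ℕ} (hd : 1 ≤ d)
    (hE : 1 ≤ E) (hEU : E ≤ U) (hr₀ : 1 ≤ r₀) {R H s : ℝ} (hR : 0 < R) (hH : 1 ≤ H)
    (hHE : H ≤ 4 ^ E)
    (hRE : 4 * R ≤ 4 ^ E) (hfE : ∀ z, ‖z‖ = 4 * R → ‖f z‖ ≤ 4 ^ E) (hT : T = 1200 * d ^ 4 * E)
    (hlarge : ∀ r : ℕ, r₀ ≤ r → r ≤ r₀ + T → 1 + T * 4 ^ (E * T) * (r : ℝ) ^ T ≤ ‖f (-(r : ℂ))‖)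
    (hs : r₀ + T + R ≤ s) (hsU : 6 * s ≤ 4 ^ U) (hfU : ∀ z, ‖z‖ ≤ 6 * s → ‖f z‖ ≤ 4 ^ U)
    (S : Finset ℂ)
    (hS : ∀ z ∈ S, ‖z‖ ≤ R ∧ DegreeLE d z (f z) ∧ height₂ z (f z) ≤ H) : S.card ≤ 4 * U * T := by
  classical
  obtain ⟨c, ⟨i₁, hi₁, j₁, hj₁, hc1⟩, hcB, hzero⟩ :=
    exists_auxiliary hf hd hE hR hH hHE hRE hfE hT
  let Q : Finset ℕ := (Finset.range T).filter fun j => ∃ i < T, c i j ≠ 0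
  have hQ : Q.Nonempty := ⟨j₁, by simpa [Q] using ⟨hj₁, i₁, hi₁, hc1⟩⟩
  -- Zeroing the entries outside the square does not change the polynomial and makes the vanishing
  -- above the leading index `J` valid also for `j ≥ T`.
  set c' : ℕ → ℕ → ℤ := fun i j => if i < T ∧ j < T then c i j else 0 with hc'
  have hcc : ∀ z w : ℂ, biEval T c z w = biEval T c' z w := by
    intro z w
    refine Finset.sum_congr rfl fun i hi => Finset.sum_congr rfl fun j hj => ?_
    rw [hc']; simp [Finset.mem_range.1 hi, Finset.mem_range.1 hj]
  obtain ⟨J, hJQ, hJmax⟩ := Q.exists_max_image id hQ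
  simp only [Q, Finset.mem_filter, Finset.mem_range, id] at hJQ hJmax
  obtain ⟨hJT, i₀, hi₀, hci₀⟩ := hJQ
  have hc'B : ∀ i j, |(c' i j : ℝ)| ≤ 4 ^ (E * T) := by
    intro i j; simp only [hc']; split_ifs
    · exact hcB i j
    · simp
  have htop : ∀ j, J < j → ∀ i < T, c' i j = 0 := by
    intro j hj i hi
    simp only [hc']
    split_ifs with h
    · by_contra hne
      exact absurd (hJmax j ⟨h.2, i, hi, hne⟩) (not_le.2 hj)
    · rfl
  obtain ⟨r, hr1, hr2, hrne⟩ := exists_sum_ne_zero (c := c') (J := J) hi₀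
    (by simpa [hc', hi₀, hJT] using hci₀) r₀
  have hr1' : (1 : ℝ) ≤ r := by exact_mod_cast hr₀.trans hr1
  set F : ℂ → ℂ := fun z => biEval T c' z (f z) with hFdef
  have hF : Differentiable ℂ F := by
    refine Differentiable.fun_sum fun i _ => Differentiable.fun_sum fun j _ => ?_
    exact ((differentiable_const _).mul (differentiable_id.pow _)).mul (hf.pow _)
  have hF1 : 1 ≤ ‖F (-(r : ℂ))‖ := by
    have := one_le_norm_biEval (x := -(r : ℤ)) hJT htop hrne (A := T * 4 ^ (E * T) * (r : ℝ) ^ T)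
      (fun j => ?_) (hlarge r hr1 hr2)
    · simpa [hFdef] using this
    · have : ∀ i ∈ Finset.range T, ‖(c' i j : ℂ) * (((-(r : ℤ) : ℤ)) : ℂ) ^ i‖ ≤
          4 ^ (E * T) * (r : ℝ) ^ T := by
        intro i hi
        rw [norm_mul, norm_pow, Complex.norm_intCast, Complex.norm_intCast]
        have h1 : |((-(r : ℤ) : ℤ) : ℝ)| = r := by simp
        rw [h1]
        have := hc'B i j
        have := pow_le_pow_right₀ hr1' (Finset.mem_range.1 hi).le
        gcongr
      refine (norm_sum_le_of_le _ this).trans (le_of_eq ?_)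
      simp [mul_assoc]
  have hTU : 1 ≤ U := hE.trans hEU
  have hrT : (r : ℝ) ≤ r₀ + T := by exact_mod_cast hr2
  -- The disc of radius `s` about `-r` contains the disc of radius `R` about `0`, and the circle of
  -- radius `5 * s` about `-r` stays within `‖z‖ ≤ 6 * s`, because `r + R ≤ s`.
  have hcard := four_pow_card_zeros_le hF (c := -(r : ℂ)) (s := s) (M := 4 ^ (4 * U * T))
    (by linarith) (fun z hz => ?_) hF1 S fun z hz => ?_
  · exact (pow_le_pow_iff_right₀ (by norm_num : (1 : ℝ) < 4)).1 hcard
  · have hz6 : ‖z‖ ≤ 6 * s := by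
      have h1 : ‖z‖ ≤ ‖z - -(r : ℂ)‖ + ‖(r : ℂ)‖ := by
        have := norm_sub_le (z - -(r : ℂ)) (r : ℂ)
        simpa using this
      rw [Complex.norm_natCast] at h1
      linarith
    have h1 := norm_biEval_le hc'B (one_le_pow₀ (by norm_num : (1 : ℝ) ≤ 4))
      (one_le_pow₀ (by norm_num : (1 : ℝ) ≤ 4)) (hz6.trans hsU) (hfU z hz6) (T := T)
    refine h1.trans ?_
    have := natCast_sq_le_four_pow T
    calc (T : ℝ) ^ 2 * 4 ^ (E * T) * (4 ^ U) ^ T * (4 ^ U) ^ T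
        ≤ 4 ^ T * 4 ^ (E * T) * (4 ^ U) ^ T * (4 ^ U) ^ T := by gcongr
      _ = 4 ^ (T + E * T + U * T + U * T) := by
          rw [← pow_mul, ← pow_add, ← pow_add, ← pow_add]
      _ ≤ 4 ^ (4 * U * T) := by
          gcongr
          · norm_num
          · nlinarith [Nat.mul_le_mul_right T hEU, Nat.mul_le_mul_right T hTU]
  · obtain ⟨hzR, hdeg, hht⟩ := hS z hz
    refine ⟨?_, by rw [hFdef]; simp only; rw [← hcc]; exact hzero z hzR hdeg hht⟩
    have h1 := norm_sub_le z (-(r : ℂ))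
    rw [norm_neg, Complex.norm_natCast] at h1
    linarith

/-! ### The kernel and its integrals -/

section

open MeasureTheory Set

/-- The kernel `Re (w / (t + w))` for `|w| = 1`, `Re w = c`. -/
def kern (c t : ℝ) : ℝ := (1 + c * t) / (1 + 2 * c * t + t ^ 2)

/-- The integrand `t ^ (σ - 1) / (1 + t)` of a beta integral. -/
def betaKer (σ t : ℝ) : ℝ := t ^ (σ - 1) / (1 + t)

/-- The difference of the two sides is `(1 - c) / 2 * (t - 1) ^ 2`. This keeps the denominator away
from zero, uniformly in terms of `1 + c`. -/
theorem kern_denom_ge {c t : ℝ} (hc1 : c ≤ 1) :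
    (1 + c) / 2 * (1 + t) ^ 2 ≤ 1 + 2 * c * t + t ^ 2 := by
  nlinarith [mul_nonneg (sub_nonneg.2 hc1) (sq_nonneg (t - 1))]

theorem kern_denom_pos {c t : ℝ} (hc : -1 < c) (hc1 : c ≤ 1) (ht : 0 ≤ t) :
    0 < 1 + 2 * c * t + t ^ 2 := by
  have := kern_denom_ge (t := t) hc1
  have : 0 < (1 + c) / 2 * (1 + t) ^ 2 := mul_pos (by linarith) (by positivity)
  linarith

theorem abs_kern_le {c t : ℝ} (hc : -1 < c) (hc1 : c ≤ 1) (ht : 0 ≤ t) :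
    |kern c t| ≤ 2 / (1 + c) * (1 / (1 + t)) := by
  have h0 := kern_denom_pos hc hc1 ht
  have h1 := kern_denom_ge (t := t) hc1
  have h2 : |1 + c * t| ≤ 1 + t := by
    rw [abs_le]; constructor <;> nlinarith
  have h3 : 0 < 1 + c := by linarith
  rw [kern, abs_div, abs_of_pos h0, div_le_iff₀ h0]
  refine h2.trans ?_
  calc 1 + t = 2 / (1 + c) * (1 / (1 + t)) * ((1 + c) / 2 * (1 + t) ^ 2) := by field_simp
    _ ≤ _ := by gcongr

theorem continuousOn_kern {c : ℝ} (hc : -1 < c) (hc1 : c ≤ 1) : ContinuousOn (kern c) (Ici 0) := by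
  unfold kern
  exact ContinuousOn.div (by fun_prop) (by fun_prop) fun t ht => (kern_denom_pos hc hc1 ht).ne'

theorem betaKer_nonneg {σ t : ℝ} (ht : 0 ≤ t) : 0 ≤ betaKer σ t := by
  unfold betaKer; positivity

theorem measurable_betaKer (σ : ℝ) : Measurable (betaKer σ) := by
  unfold betaKer; fun_prop

theorem integrableOn_betaKer {σ : ℝ} (h0 : 0 < σ) (h1 : σ ≤ 1 / 2) :
    IntegrableOn (betaKer σ) (Ioi 0) ∧ ∫ t in Ioi 0, betaKer σ t ≤ 1 / σ + 2 := by
  have iA : IntegrableOn (fun t : ℝ => t ^ (σ - 1)) (Ioc 0 1) := by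
    rw [← intervalIntegrable_iff_integrableOn_Ioc_of_le zero_le_one]
    exact intervalIntegral.intervalIntegrable_rpow' (by linarith)
  have iB : IntegrableOn (fun t : ℝ => t ^ (σ - 2)) (Ioi 1) :=
    integrableOn_Ioi_rpow_of_lt (by linarith) one_pos
  have bA : ∀ t ∈ Ioc (0 : ℝ) 1, betaKer σ t ≤ t ^ (σ - 1) := fun t ht =>
    div_le_self (Real.rpow_nonneg ht.1.le _) (by linarith [ht.1])
  have bB : ∀ t ∈ Ioi (1 : ℝ), betaKer σ t ≤ t ^ (σ - 2) := fun t ht => by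
    have ht' : (1 : ℝ) < t := ht
    have h2 : t ^ (σ - 2) = t ^ (σ - 1) / t := by
      rw [← Real.rpow_sub_one (by positivity)]; congr 1; ring
    rw [betaKer, h2]
    exact div_le_div_of_nonneg_left (by positivity) (by positivity) (by linarith)
  have jA : IntegrableOn (betaKer σ) (Ioc 0 1) :=
    Integrable.mono' iA (measurable_betaKer σ).aestronglyMeasurable
      ((ae_restrict_iff' measurableSet_Ioc).2 (Eventually.of_forall fun t ht => by
        rw [Real.norm_of_nonneg (betaKer_nonneg ht.1.le)]; exact bA t ht))
  have jB : IntegrableOn (betaKer σ) (Ioi 1) :=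
    Integrable.mono' iB (measurable_betaKer σ).aestronglyMeasurable
      ((ae_restrict_iff' measurableSet_Ioi).2 (Eventually.of_forall fun t ht => by
        rw [Real.norm_of_nonneg (betaKer_nonneg (zero_le_one.trans (le_of_lt ht)))]; exact bB t ht))
  have hU : Ioi (0 : ℝ) = Ioc 0 1 ∪ Ioi 1 := (Ioc_union_Ioi_eq_Ioi zero_le_one).symm
  refine ⟨hU ▸ jA.union jB, ?_⟩
  rw [hU, setIntegral_union (Ioc_disjoint_Ioi le_rfl) measurableSet_Ioi jA jB]
  have e1 : ∫ t in Ioc 0 1, betaKer σ t ≤ 1 / σ := by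
    refine (setIntegral_mono_on jA iA measurableSet_Ioc bA).trans (le_of_eq ?_)
    rw [← intervalIntegral.integral_of_le zero_le_one, integral_rpow (Or.inl (by linarith))]
    simp [h0.ne']
  have e2 : ∫ t in Ioi 1, betaKer σ t ≤ 2 := by
    refine (setIntegral_mono_on jB iB measurableSet_Ioi bB).trans ?_
    rw [integral_Ioi_rpow_of_lt (by linarith) one_pos, Real.one_rpow, neg_div, ← div_neg,
      div_le_iff₀ (by linarith)]
    linarith
  linarith

theorem rpow_mul_kern_div {c t σ : ℝ} (hc : -1 < c) (hc1 : c ≤ 1) (ht : 0 < t) :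
    t ^ σ * |kern c t / t| ≤ 2 / (1 + c) * betaKer σ t := by
  have h := abs_kern_le hc hc1 ht.le
  rw [abs_div, abs_of_pos ht, betaKer, Real.rpow_sub_one ht.ne']
  calc t ^ σ * (|kern c t| / t) ≤ t ^ σ * (2 / (1 + c) * (1 / (1 + t)) / t) := by gcongr
    _ = _ := by field_simp

theorem aestronglyMeasurable_kern_div {c : ℝ} (hc : -1 < c) (hc1 : c ≤ 1) :
    AEStronglyMeasurable (fun t => kern c t / t) (volume.restrict (Ioi 0)) := by
  refine ContinuousOn.aestronglyMeasurable ?_ measurableSet_Ioi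
  exact ((continuousOn_kern hc hc1).mono Ioi_subset_Ici_self).div continuousOn_id
    fun t ht => (ne_of_gt ht)

theorem integrableOn_mul_kern_div {c : ℝ} (hc : -1 < c) (hc1 : c ≤ 1) {g : ℝ → ℝ} {K σ : ℝ}
    (hg : AEStronglyMeasurable g (volume.restrict (Ioi 0))) (h0 : 0 < σ) (h1 : σ ≤ 1 / 2)
    (hK : ∀ t, 0 < t → |g t| ≤ K * t ^ σ) :
    IntegrableOn (fun t => g t * (kern c t / t)) (Ioi 0) := by
  refine Integrable.mono' (((integrableOn_betaKer h0 h1).1.const_mul (K * (2 / (1 + c)))))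
    (hg.mul (aestronglyMeasurable_kern_div hc hc1))
    ((ae_restrict_iff' measurableSet_Ioi).2 (Eventually.of_forall fun t ht => ?_))
  have ht' : 0 < t := ht
  have hK0 : 0 ≤ K := by
    have := (abs_nonneg _).trans (hK 1 one_pos); simpa using this
  rw [norm_mul, Real.norm_eq_abs, Real.norm_eq_abs]
  calc |g t| * |kern c t / t| ≤ K * t ^ σ * |kern c t / t| := by gcongr; exact hK t ht'
    _ = K * (t ^ σ * |kern c t / t|) := by ring
    _ ≤ K * (2 / (1 + c) * betaKer σ t) :=
      mul_le_mul_of_nonneg_left (rpow_mul_kern_div hc hc1 ht') hK0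
    _ = _ := by ring

/-- With `|w| = 1` and `Re w = c` the primitive is `-log |1 + w / t|`, which tends to `0` at
infinity; so the integral of `kern c t / t` over `(a, ∞)` is `log |1 + w / a|`. -/
theorem hasDerivAt_log_kern {c t : ℝ} (hc : -1 < c) (hc1 : c ≤ 1) (ht : 0 < t) :
    HasDerivAt (fun t => -(1 / 2 * Real.log (1 + 2 * c / t + 1 / t ^ 2))) (kern c t / t) t := by
  have h0 := kern_denom_pos hc hc1 ht.le
  have e : 1 + 2 * c / t + 1 / t ^ 2 = (1 + 2 * c * t + t ^ 2) / t ^ 2 := by field_simp; ring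
  have hne : 1 + 2 * c / t + 1 / t ^ 2 ≠ 0 := by rw [e]; positivity
  have h1 : HasDerivAt (fun t : ℝ => 2 * c / t) ((0 * t - 2 * c * 1) / t ^ 2) t :=
    (hasDerivAt_const t (2 * c)).div (hasDerivAt_id t) ht.ne'
  have h2 : HasDerivAt (fun t : ℝ => 1 / t ^ 2) ((0 * t ^ 2 - 1 * (2 * t)) / (t ^ 2) ^ 2) t :=
    ((hasDerivAt_const t (1 : ℝ)).div (hasDerivAt_pow 2 t) (by positivity)).congr_deriv (by simp)
  have h3 := ((((h1.const_add 1).add h2).log hne).const_mul (1 / 2)).neg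
  refine h3.congr_deriv ?_
  simp only [Pi.add_apply]
  rw [e, kern]
  field_simp
  ring

theorem tendsto_log_kern (c : ℝ) :
    Tendsto (fun t : ℝ => -(1 / 2 * Real.log (1 + 2 * c / t + 1 / t ^ 2))) atTop (𝓝 0) := by
  have h : ContinuousAt (fun u : ℝ => -(1 / 2 * Real.log (1 + 2 * c * u + u ^ 2))) 0 := by
    have : ContinuousAt (fun u : ℝ => Real.log (1 + 2 * c * u + u ^ 2)) 0 :=
      ContinuousAt.log (by fun_prop) (by norm_num)
    exact (this.const_mul _).neg
  have h2 := h.tendsto.comp tendsto_inv_atTop_zero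
  simp only [mul_zero, ne_eq, OfNat.ofNat_ne_zero, not_false_eq_true, zero_pow, add_zero,
    Real.log_one, neg_zero] at h2
  refine h2.congr fun t => ?_
  simp [div_eq_mul_inv]

theorem integral_kern_div {c a : ℝ} (hc : -1 < c) (hc1 : c ≤ 1) (ha : 0 < a) :
    IntegrableOn (fun t => kern c t / t) (Ioi a) ∧
    (∫ t in Ioi a, ‖kern c t / t‖) ≤ 2 / (1 + c) * (1 / a) ∧
    ∫ t in Ioi a, kern c t / t = 1 / 2 * Real.log (1 + 2 * c / a + 1 / a ^ 2) := by
  have hb : ∀ t ∈ Ioi a, ‖kern c t / t‖ ≤ 2 / (1 + c) * t ^ (-2 : ℝ) := by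
    intro t ht
    have ht' : 0 < t := ha.trans ht
    have h1 := abs_kern_le hc hc1 ht'.le
    have h2 : (t : ℝ) ^ (-2 : ℝ) = 1 / t / t := by
      rw [Real.rpow_neg ht'.le, Real.rpow_two]; field_simp
    have h3 : 0 < 1 + c := by linarith
    rw [norm_div, Real.norm_eq_abs, Real.norm_of_nonneg ht'.le, h2, ← mul_div_assoc]
    gcongr
    refine h1.trans ?_
    gcongr
    linarith
  have hi2 : IntegrableOn (fun t : ℝ => 2 / (1 + c) * t ^ (-2 : ℝ)) (Ioi a) :=
    (integrableOn_Ioi_rpow_of_lt (by norm_num) ha).const_mul _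
  have hi : IntegrableOn (fun t => kern c t / t) (Ioi a) :=
    Integrable.mono' hi2 ((aestronglyMeasurable_kern_div hc hc1).mono_measure
      (Measure.restrict_mono (Ioi_subset_Ioi ha.le) le_rfl))
      ((ae_restrict_iff' measurableSet_Ioi).2 (Eventually.of_forall hb))
  refine ⟨hi, ?_, ?_⟩
  · refine (setIntegral_mono_on hi.norm hi2 measurableSet_Ioi hb).trans (le_of_eq ?_)
    rw [integral_const_mul, integral_Ioi_rpow_of_lt (by norm_num) ha]
    norm_num [Real.rpow_neg_one]
  · rw [integral_Ioi_of_hasDerivAt_of_tendsto'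
      (fun t ht => hasDerivAt_log_kern hc hc1 (ha.trans_le ht)) hi (tendsto_log_kern c)]
    ring

/-- Summation by parts: a sum over the points `b n` as an integral against the counting
function. -/
theorem hasSum_log_eq_integral {c : ℝ} (hc : -1 < c) (hc1 : c ≤ 1) {b : ℕ → ℝ} (hb : ∀ n, 0 < b n)
    (hs : Summable fun n => 1 / b n) {ν : ℝ → ℝ}
    (hν : ∀ t, 0 < t → HasSum (fun n => if b n < t then (1 : ℝ) else 0) (ν t)) :
    HasSum (fun n => 1 / 2 * Real.log (1 + 2 * c / b n + 1 / b n ^ 2))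
      (∫ t in Ioi 0, ν t * (kern c t / t)) := by
  have hind : ∀ n, (Ioi (b n)).indicator (fun t => kern c t / t) =
      fun t => (if b n < t then (1 : ℝ) else 0) * (kern c t / t) := by
    intro n; funext t; by_cases h : b n < t <;> simp [h, indicator]
  have hinter : ∀ n, Ioi (0 : ℝ) ∩ Ioi (b n) = Ioi (b n) := fun n =>
    inter_eq_right.2 (Ioi_subset_Ioi (hb n).le)
  have key := hasSum_integral_of_summable_integral_norm (μ := volume.restrict (Ioi (0 : ℝ)))
    (F := fun n => (Ioi (b n)).indicator (fun t => kern c t / t))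
    (fun n => by
      rw [integrable_indicator_iff measurableSet_Ioi, IntegrableOn,
        Measure.restrict_restrict measurableSet_Ioi, inter_comm, hinter]
      exact (integral_kern_div hc hc1 (hb n)).1)
    (by
      refine Summable.of_nonneg_of_le (fun n => integral_nonneg fun _ => norm_nonneg _)
        (fun n => ?_) (hs.mul_left (2 / (1 + c)))
      simp_rw [norm_indicator_eq_indicator_norm]
      rw [setIntegral_indicator measurableSet_Ioi, hinter]
      exact (integral_kern_div hc hc1 (hb n)).2.1)
  have e1 : (fun n => ∫ t in Ioi 0, (Ioi (b n)).indicator (fun t => kern c t / t) t) =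
      fun n => 1 / 2 * Real.log (1 + 2 * c / b n + 1 / b n ^ 2) := by
    funext n
    rw [setIntegral_indicator measurableSet_Ioi, hinter]
    exact (integral_kern_div hc hc1 (hb n)).2.2
  have e2 : ∫ t in Ioi 0, ∑' n, (Ioi (b n)).indicator (fun t => kern c t / t) t =
      ∫ t in Ioi 0, ν t * (kern c t / t) := by
    refine setIntegral_congr_fun measurableSet_Ioi fun t ht => ?_
    simp only [hind]
    exact ((hν t ht).mul_right _).tsum_eq
  rw [← e1, ← e2]
  exact key

/-- The substitution `t = s ^ 2` gives a rational integrand, whose denominator factors as `(s² + 2bs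
+ 1)(s² - 2bs + 1)`. For `c = cos θ` with `0 ≤ θ < π`, `a = cos (θ/2)` and `b = sin (θ/2)`; the
arctangents contribute `π a` and the logarithms cancel at both ends. -/
theorem integral_half_kern {c : ℝ} (hc : -1 < c) (hc1 : c ≤ 1) :
    ∫ t in Ioi 0, t ^ (1 / 2 : ℝ) * (kern c t / t) = Real.pi * √((1 + c) / 2) := by
  set a := √((1 + c) / 2) with ha
  set b := √((1 - c) / 2) with hb
  have ha2 : a ^ 2 = (1 + c) / 2 := Real.sq_sqrt (by linarith)
  have hb2 : b ^ 2 = (1 - c) / 2 := Real.sq_sqrt (by linarith)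
  have ha0 : 0 < a := Real.sqrt_pos.2 (by linarith)
  have hqp : ∀ s : ℝ, s ^ 2 + 2 * b * s + 1 = (s + b) ^ 2 + a ^ 2 := fun s => by
    linear_combination - ha2 - hb2
  have hqm : ∀ s : ℝ, s ^ 2 - 2 * b * s + 1 = (s - b) ^ 2 + a ^ 2 := fun s => by
    linear_combination - ha2 - hb2
  have hqp0 : ∀ s : ℝ, 0 < s ^ 2 + 2 * b * s + 1 := fun s => by rw [hqp]; positivity
  have hqm0 : ∀ s : ℝ, 0 < s ^ 2 - 2 * b * s + 1 := fun s => by rw [hqm]; positivity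
  let G : ℝ → ℝ := fun s => a * (Real.arctan ((s + b) / a) + Real.arctan ((s - b) / a)) +
    b / 2 * (Real.log (s ^ 2 + 2 * b * s + 1) - Real.log (s ^ 2 - 2 * b * s + 1))
  have hG : ∀ s, HasDerivAt G (2 * kern c (s ^ 2)) s := by
    intro s
    have h1 := (((hasDerivAt_id s).add_const b).div_const a).arctan
    have h2 := (((hasDerivAt_id s).sub_const b).div_const a).arctan
    have h3 : HasDerivAt (fun s : ℝ => s ^ 2 + 2 * b * s + 1) (2 * s + 2 * b) s := by
      simpa using ((hasDerivAt_pow 2 s).add ((hasDerivAt_id s).const_mul (2 * b))).add_const 1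
    have h4 : HasDerivAt (fun s : ℝ => s ^ 2 - 2 * b * s + 1) (2 * s - 2 * b) s := by
      simpa using ((hasDerivAt_pow 2 s).sub ((hasDerivAt_id s).const_mul (2 * b))).add_const 1
    have h5 := ((h1.add h2).const_mul a).add
      (((h3.log (hqp0 s).ne').sub (h4.log (hqm0 s).ne')).const_mul (b / 2))
    refine h5.congr_deriv ?_
    have e1 : 1 + ((id s + b) / a) ^ 2 = (s ^ 2 + 2 * b * s + 1) / a ^ 2 := by
      rw [hqp]; field_simp; simp; ring
    have e2 : 1 + ((id s - b) / a) ^ 2 = (s ^ 2 - 2 * b * s + 1) / a ^ 2 := by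
      rw [hqm]; field_simp; simp; ring
    have e3 : 1 + 2 * c * s ^ 2 + (s ^ 2) ^ 2 =
        (s ^ 2 + 2 * b * s + 1) * (s ^ 2 - 2 * b * s + 1) := by
      linear_combination (4 * s ^ 2) * hb2
    have hp := (hqp0 s).ne'
    have hm := (hqm0 s).ne'
    rw [e1, e2, kern, e3]
    generalize hP : s ^ 2 + 2 * b * s + 1 = P at *
    generalize hQ : s ^ 2 - 2 * b * s + 1 = Q at *
    field_simp
    rw [← hP, ← hQ]
    linear_combination (2 * s ^ 2 + 2) * ha2 + (2 - 2 * s ^ 2) * hb2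
  have hGc : Continuous G := continuous_iff_continuousAt.2 fun s => (hG s).continuousAt
  have hG0 : G (√0) = 0 := by
    have : (0 - b) / a = -((0 + b) / a) := by ring
    simp only [G, Real.sqrt_zero, this, Real.arctan_neg]; simp
  have hlim : Tendsto G atTop (𝓝 (Real.pi * a)) := by
    have h1 : Tendsto (fun s : ℝ => Real.arctan ((s + b) / a)) atTop (𝓝 (Real.pi / 2)) :=
      (tendsto_nhds_of_tendsto_nhdsWithin Real.tendsto_arctan_atTop).comp
        ((tendsto_atTop_add_const_right _ b tendsto_id).atTop_div_const ha0)
    have h2 : Tendsto (fun s : ℝ => Real.arctan ((s - b) / a)) atTop (𝓝 (Real.pi / 2)) :=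
      (tendsto_nhds_of_tendsto_nhdsWithin Real.tendsto_arctan_atTop).comp
        ((tendsto_atTop_add_const_right _ (-b) tendsto_id).atTop_div_const ha0)
    have h3 : Tendsto (fun s : ℝ => Real.log (s ^ 2 + 2 * b * s + 1) -
        Real.log (s ^ 2 - 2 * b * s + 1)) atTop (𝓝 0) := by
      have hcont : ContinuousAt (fun u : ℝ => Real.log (1 + 2 * b * u + u ^ 2) -
          Real.log (1 - 2 * b * u + u ^ 2)) 0 := by
        refine ContinuousAt.sub ?_ ?_
        · exact ContinuousAt.log (by fun_prop) (by norm_num)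
        · exact ContinuousAt.log (by fun_prop) (by norm_num)
      have h := hcont.tendsto.comp tendsto_inv_atTop_zero
      simp only [mul_zero, ne_eq, OfNat.ofNat_ne_zero, not_false_eq_true, zero_pow, add_zero,
        sub_zero, Real.log_one] at h
      refine h.congr' ?_
      filter_upwards [eventually_gt_atTop 0] with s hs
      have e1 : s ^ 2 + 2 * b * s + 1 = s ^ 2 * (1 + 2 * b * s⁻¹ + s⁻¹ ^ 2) := by field_simp
      have e2 : s ^ 2 - 2 * b * s + 1 = s ^ 2 * (1 - 2 * b * s⁻¹ + s⁻¹ ^ 2) := by field_simp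
      have p1 := hqp0 s
      have p2 := hqm0 s
      rw [e1] at p1
      rw [e2] at p2
      have q1 := (pos_iff_pos_of_mul_pos p1).1 (by positivity)
      have q2 := (pos_iff_pos_of_mul_pos p2).1 (by positivity)
      simp only [Function.comp]
      rw [e1, e2, Real.log_mul (by positivity) q1.ne', Real.log_mul (by positivity) q2.ne']
      ring
    have h := ((h1.add h2).const_mul a).add (h3.const_mul (b / 2))
    have e : a * (Real.pi / 2 + Real.pi / 2) + b / 2 * 0 = Real.pi * a := by ring
    rwa [e] at h
  have hd : ∀ t ∈ Ioi (0 : ℝ),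
      HasDerivAt (fun t => G (√t)) (t ^ (1 / 2 : ℝ) * (kern c t / t)) t := by
    intro t ht
    have ht' : (0 : ℝ) < t := ht
    have h := (hG (√t)).comp t (Real.hasDerivAt_sqrt ht'.ne')
    refine h.congr_deriv ?_
    rw [Real.sq_sqrt ht'.le, ← Real.sqrt_eq_rpow]
    have hs : 0 < √t := Real.sqrt_pos.2 ht'
    field_simp
    rw [Real.sq_sqrt ht'.le]
  have hint : IntegrableOn (fun t => t ^ (1 / 2 : ℝ) * (kern c t / t)) (Ioi 0) :=
    integrableOn_mul_kern_div hc hc1 (K := 1) (σ := 1 / 2)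
      (Measurable.aestronglyMeasurable (by fun_prop)) (by norm_num) le_rfl
      fun t ht => by rw [one_mul, abs_of_nonneg (by positivity)]
  rw [integral_Ioi_of_hasDerivAt_of_tendsto (f := fun t => G (√t)) (m := Real.pi * a)
    (hGc.comp Real.continuous_sqrt).continuousWithinAt hd hint
    (hlim.comp Real.tendsto_sqrt_atTop), hG0, sub_zero]

/-- Reduction to exponent `1/2`: the kernel changes sign at `t = 1 / x`, from positive to negative,
and `(x * t) ^ e` is at most `1` before that point and at least `1` after it. Multiplying by this
weight therefore only decreases the integral. The hypothesis `c ≤ -4/5` keeps `x ^ e` bounded below.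
-/
theorem le_integral_rpow_kern {c ρ : ℝ} (hc : -1 < c) (hc1 : c ≤ -(4 / 5)) (h0 : 0 < ρ)
    (h1 : ρ ≤ 1 / 2) : 1 + c ≤ ∫ t in Ioi 0, t ^ ρ * (kern c t / t) := by
  have hc1' : c ≤ 1 := by linarith
  set x := -c with hx
  have hx0 : 0 < x := by rw [hx]; linarith
  set e := 1 / 2 - ρ with he
  have hint : ∀ σ : ℝ, 0 < σ → σ ≤ 1 / 2 →
      IntegrableOn (fun t => t ^ σ * (kern c t / t)) (Ioi 0) := fun σ h0 h1 =>
    integrableOn_mul_kern_div hc hc1' (K := 1) (σ := σ)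
      (Measurable.aestronglyMeasurable (by fun_prop)) h0 h1
      fun t ht => by rw [one_mul, abs_of_nonneg (by positivity)]
  have hpt : ∀ t ∈ Ioi (0 : ℝ), x ^ e * (t ^ (1 / 2 : ℝ) * (kern c t / t)) ≤
      t ^ ρ * (kern c t / t) := by
    intro t ht
    have ht' : (0 : ℝ) < t := ht
    have hden := kern_denom_pos hc hc1' ht'.le
    have e1 : (t : ℝ) ^ (1 / 2 : ℝ) = t ^ ρ * t ^ e := by
      rw [← Real.rpow_add ht']; congr 1; rw [he]; ring
    have e2 : x ^ e * (t ^ (1 / 2 : ℝ) * (kern c t / t)) =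
        t ^ ρ * ((x * t) ^ e * (kern c t / t)) := by
      rw [e1, Real.mul_rpow hx0.le ht'.le]; ring
    rw [e2]
    gcongr
    rcases le_or_gt (x * t) 1 with h | h
    · have hk : 0 ≤ kern c t / t := by
        unfold kern
        have : 0 ≤ 1 + c * t := by rw [hx] at h; linarith
        positivity
      refine mul_le_of_le_one_left hk (Real.rpow_le_one (by positivity) h (by rw [he]; linarith))
    · have hk : kern c t / t ≤ 0 := by
        unfold kern
        have : 1 + c * t ≤ 0 := by rw [hx] at h; linarith
        exact div_nonpos_of_nonpos_of_nonneg (div_nonpos_of_nonpos_of_nonneg this hden.le) ht'.le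
      have := Real.one_le_rpow h.le (show 0 ≤ e by rw [he]; linarith)
      nlinarith
  have hmono := setIntegral_mono_on ((hint (1 / 2) (by norm_num) le_rfl).const_mul (x ^ e))
    (hint ρ h0 h1) measurableSet_Ioi hpt
  refine le_trans ?_ hmono
  rw [integral_const_mul, integral_half_kern hc hc1']
  have hxe : 4 / 5 ≤ x ^ e := by
    have h2 : x ^ (1 : ℝ) ≤ x ^ e :=
      Real.rpow_le_rpow_of_exponent_ge hx0 (by rw [hx]; linarith) (by rw [he]; linarith)
    rw [Real.rpow_one] at h2
    rw [hx] at *; linarith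
  have hs : (1 + c) / 2 ≤ √((1 + c) / 2) := by
    apply Real.le_sqrt_of_sq_le; nlinarith
  have hs0 : 0 ≤ √((1 + c) / 2) := Real.sqrt_nonneg _
  have hpi := Real.pi_gt_three
  have hc2 : 0 ≤ (1 + c) / 2 := by linarith
  calc 1 + c ≤ 4 / 5 * (3 * ((1 + c) / 2)) := by linarith
    _ ≤ x ^ e * (Real.pi * √((1 + c) / 2)) := by gcongr

end

/-! ### The modulus of the canonical product through its counting function -/

section

open MeasureTheory Set

theorem differentiable_canonicalProduct {a : ℕ → ℝ} (h1 : ∀ n, 1 ≤ a n)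
    (hs : Summable fun n => 1 / a n) : Differentiable ℂ (canonicalProduct a) := by
  intro z
  have hu : Summable fun n => (‖z‖ + 1) * (1 / a n) := hs.mul_left _
  have key := hu.hasProdLocallyUniformlyOn_nat_one_add (f := fun n (w : ℂ) => -(w / (a n : ℂ)))
    (Metric.isOpen_ball (x := (0 : ℂ)) (ε := ‖z‖ + 1)) (Eventually.of_forall fun n w hw => by
      have h0 : 0 < a n := one_pos.trans_le (h1 n)
      rw [norm_neg, norm_div, Complex.norm_real, Real.norm_of_nonneg h0.le, div_eq_mul_one_div]
      have := (mem_ball_zero_iff.1 hw).le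
      gcongr) fun n => by fun_prop
  rw [hasProdLocallyUniformlyOn_iff_tendstoLocallyUniformlyOn] at key
  have hd := key.differentiableOn (Eventually.of_forall fun s => by
    refine DifferentiableOn.fun_finsetProd fun n _ => ?_
    exact ((differentiable_const _).add (differentiable_id.div_const _).neg).differentiableOn)
    Metric.isOpen_ball
  have hz : z ∈ Metric.ball (0 : ℂ) (‖z‖ + 1) := by simp
  have := hd.differentiableAt (Metric.isOpen_ball.mem_nhds hz)
  refine this.congr_of_eventuallyEq (Eventually.of_forall fun w => ?_)
  simp [canonicalProduct, sub_eq_add_neg]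

theorem finite_setOf_lt {a : ℕ → ℝ} (h1 : ∀ n, 1 ≤ a n) (hs : Summable fun n => 1 / a n) (r : ℝ) :
    {k | a k < r}.Finite := by
  rcases le_or_gt r 0 with hr | hr
  · refine Set.Finite.subset Set.finite_empty fun k hk => ?_
    have := h1 k
    have hk' : a k < r := hk
    linarith
  · have h := hs.tendsto_cofinite_zero.eventually (gt_mem_nhds (one_div_pos.2 hr))
    rw [eventually_cofinite] at h
    refine h.subset fun k hk => ?_
    have hk' : a k < r := hk
    exact not_lt.2 (one_div_le_one_div_of_le (one_pos.trans_le (h1 k)) hk'.le)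

theorem hasSum_zeroCount {a : ℕ → ℝ} (h1 : ∀ n, 1 ≤ a n) (hs : Summable fun n => 1 / a n) (r : ℝ) :
    HasSum (fun n => if a n < r then (1 : ℝ) else 0) (zeroCount a r) := by
  have hf := finite_setOf_lt h1 hs r
  have h : (zeroCount a r : ℝ) = ∑ n ∈ hf.toFinset, if a n < r then (1 : ℝ) else 0 := by
    rw [Finset.sum_congr rfl (g := fun _ => (1 : ℝ)) fun n hn => if_pos (by simpa using hn)]
    rw [zeroCount, Set.ncard_eq_toFinset_card _ hf]; simp
  rw [h]
  exact hasSum_sum_of_ne_finset_zero fun n hn => if_neg (by simpa using hn)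

theorem zeroCount_mono {a : ℕ → ℝ} (h1 : ∀ n, 1 ≤ a n) (hs : Summable fun n => 1 / a n) :
    Monotone (zeroCount a) := fun _ s hrs =>
  Set.ncard_le_ncard (fun _ hk => lt_of_lt_of_le hk hrs) (finite_setOf_lt h1 hs s)

theorem zeroCount_eq_zero {a : ℕ → ℝ} (h1 : ∀ n, 1 ≤ a n) {r : ℝ} (hr : r ≤ 1) :
    zeroCount a r = 0 := by
  have : {k | a k < r} = ∅ := by
    ext k; simpa using hr.trans (h1 k)
  rw [zeroCount, this, Set.ncard_empty]

/-- The sum of the logarithms of `|1 - z / aₙ|` for `|z| = r`, `Re z = -c r`, as an integral. -/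
theorem hasSum_log_zeros {a : ℕ → ℝ} (h1 : ∀ n, 1 ≤ a n) (hs : Summable fun n => 1 / a n)
    {c r : ℝ} (hc : -1 < c) (hc1 : c ≤ 1) (hr : 0 < r) :
    HasSum (fun n => 1 / 2 * Real.log (1 + 2 * c * (r / a n) + (r / a n) ^ 2))
      (∫ t in Ioi 0, (zeroCount a (r * t) : ℝ) * (kern c t / t)) := by
  have ha : ∀ n, 0 < a n := fun n => one_pos.trans_le (h1 n)
  have := hasSum_log_eq_integral hc hc1 (b := fun n => a n / r) (fun n => div_pos (ha n) hr)
    (by simpa [one_div_div, div_eq_mul_one_div r] using hs.mul_left r)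
    (ν := fun t => (zeroCount a (r * t) : ℝ)) (fun t _ => by
      simpa [div_lt_iff₀ hr, mul_comm t r] using hasSum_zeroCount h1 hs (r * t))
  refine this.congr_fun fun n => ?_
  have := ha n
  congr 2
  field_simp

theorem norm_one_sub_div_sq {z : ℂ} {x : ℝ} :
    ‖1 - z / (x : ℂ)‖ ^ 2 = 1 - 2 * z.re / x + (‖z‖ / x) ^ 2 := by
  rw [div_pow, ← Complex.normSq_eq_norm_sq, ← Complex.normSq_eq_norm_sq, Complex.normSq_apply,
    Complex.normSq_apply]
  simp only [Complex.sub_re, Complex.one_re, Complex.div_ofReal_re, Complex.sub_im, Complex.one_im,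
    Complex.div_ofReal_im]
  ring

theorem exp_half_log {x : ℝ} (hx : 0 < x) : Real.exp (1 / 2 * Real.log x) = √x := by
  rw [Real.sqrt_eq_rpow, Real.rpow_def_of_pos hx, mul_comm]

/-- Termwise: `|1 - z/aₙ|² = 1 - 2 Re z / aₙ + (|z|/aₙ)²` decreases as `Re z` grows, so replacing
`Re z` by its upper bound `-c * ‖z‖` gives a lower bound for each factor. -/
theorem exp_integral_le_norm_canonicalProduct {a : ℕ → ℝ} (h1 : ∀ n, 1 ≤ a n)
    (hs : Summable fun n => 1 / a n) {c : ℝ} (hc : -1 < c) (hc1 : c ≤ 1) {z : ℂ} (hz : z ≠ 0)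
    (hre : z.re ≤ -c * ‖z‖) :
    Real.exp (∫ t in Ioi 0, (zeroCount a (‖z‖ * t) : ℝ) * (kern c t / t)) ≤
      ‖canonicalProduct a z‖ := by
  have hr : 0 < ‖z‖ := norm_pos_iff.2 hz
  have hA := (hasSum_log_zeros h1 hs hc hc1 hr).rexp
  have hB := (hasProd_canonicalProduct a h1 hs z).norm
  refine le_of_tendsto_of_tendsto' hA hB fun s => ?_
  refine Finset.prod_le_prod (fun _ _ => (Real.exp_pos _).le) fun n _ => ?_
  have ha : 0 < a n := one_pos.trans_le (h1 n)
  have hden := kern_denom_pos hc hc1 (div_pos hr ha).le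
  rw [Function.comp, exp_half_log hden]
  refine Real.sqrt_le_iff.2 ⟨norm_nonneg _, ?_⟩
  rw [norm_one_sub_div_sq]
  have : z.re / a n ≤ -c * ‖z‖ / a n := by gcongr
  have e : 2 * c * (‖z‖ / a n) = -(2 * (-c * ‖z‖ / a n)) := by ring
  have e' : 2 * z.re / a n = 2 * (z.re / a n) := mul_div_assoc _ _ _
  rw [e, e']
  linarith

theorem norm_canonicalProduct_le_exp_integral {a : ℕ → ℝ} (h1 : ∀ n, 1 ≤ a n)
    (hs : Summable fun n => 1 / a n) {z : ℂ} (hz : z ≠ 0) :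
    ‖canonicalProduct a z‖ ≤
      Real.exp (∫ t in Ioi 0, (zeroCount a (‖z‖ * t) : ℝ) * (kern 1 t / t)) := by
  have hr : 0 < ‖z‖ := norm_pos_iff.2 hz
  have hA := (hasSum_log_zeros h1 hs (c := 1) (by norm_num) le_rfl hr).rexp
  have hB := (hasProd_canonicalProduct a h1 hs z).norm
  refine le_of_tendsto_of_tendsto' hB hA fun s => ?_
  refine Finset.prod_le_prod (fun _ _ => norm_nonneg _) fun n _ => ?_
  have ha : 0 < a n := one_pos.trans_le (h1 n)
  have e : 1 + 2 * 1 * (‖z‖ / a n) + (‖z‖ / a n) ^ 2 = (1 + ‖z‖ / a n) ^ 2 := by ring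
  have hp : 0 < 1 + ‖z‖ / a n := by positivity
  rw [Function.comp, e, exp_half_log (by positivity), Real.sqrt_sq hp.le]
  refine (norm_sub_le _ _).trans ?_
  rw [norm_one, norm_div, Complex.norm_real, Real.norm_of_nonneg ha.le]

theorem measurable_zeroCount_mul {a : ℕ → ℝ} (h1 : ∀ n, 1 ≤ a n) (hs : Summable fun n => 1 / a n)
    {r : ℝ} (hr : 0 ≤ r) : Measurable fun t => (zeroCount a (r * t) : ℝ) := by
  refine Monotone.measurable fun s t hst => ?_
  simp only [Nat.cast_le]
  exact zeroCount_mono h1 hs (by gcongr)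

/-- Two powers are allowed because the error in the counting function has a part proportional to the
main power and a part of lower order. -/
theorem abs_integral_mul_kern_le {c : ℝ} (hc : -1 < c) (hc1 : c ≤ 1) {g : ℝ → ℝ}
    {A B σ τ : ℝ} (h0 : 0 < σ) (h1 : σ ≤ 1 / 2) (k0 : 0 < τ) (k1 : τ ≤ 1 / 2) (hA : 0 ≤ A)
    (hB : 0 ≤ B) (hg : ∀ t, 0 < t → |g t| ≤ A * t ^ σ + B * t ^ τ) :
    |∫ t in Ioi 0, g t * (kern c t / t)| ≤
      2 / (1 + c) * (A * (1 / σ + 2) + B * (1 / τ + 2)) := by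
  obtain ⟨i1, b1⟩ := integrableOn_betaKer h0 h1
  obtain ⟨i2, b2⟩ := integrableOn_betaKer k0 k1
  have hc0 : 0 < 1 + c := by linarith
  have hi := ((i1.const_mul A).add (i2.const_mul B)).const_mul (2 / (1 + c))
  have := norm_integral_le_of_norm_le (μ := volume.restrict (Ioi 0))
    (f := fun t => g t * (kern c t / t)) hi ((ae_restrict_iff' measurableSet_Ioi).2
      (Eventually.of_forall fun t ht => ?_))
  · rw [Real.norm_eq_abs] at this
    refine this.trans ?_
    simp only [Pi.add_apply]
    rw [integral_const_mul, integral_add (i1.const_mul A) (i2.const_mul B), integral_const_mul,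
      integral_const_mul]
    gcongr
  · have ht' : (0 : ℝ) < t := ht
    have e1 := mul_le_mul_of_nonneg_left (rpow_mul_kern_div (σ := σ) hc hc1 ht') hA
    have e2 := mul_le_mul_of_nonneg_left (rpow_mul_kern_div (σ := τ) hc hc1 ht') hB
    rw [norm_mul, Real.norm_eq_abs, Real.norm_eq_abs]
    simp only [Pi.add_apply]
    have := mul_le_mul_of_nonneg_right (hg t ht') (abs_nonneg (kern c t / t))
    linarith

theorem norm_canonicalProduct_le {a : ℕ → ℝ} (h1 : ∀ n, 1 ≤ a n)
    (hs : Summable fun n => 1 / a n) {K ρ : ℝ} (h0 : 0 < ρ) (hρ : ρ ≤ 1 / 2)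
    (hK : ∀ s, 0 < s → (zeroCount a s : ℝ) ≤ K * s ^ ρ) (z : ℂ) :
    ‖canonicalProduct a z‖ ≤ Real.exp (K * (1 / ρ + 2) * ‖z‖ ^ ρ) := by
  rcases eq_or_ne z 0 with rfl | hz
  · simp [canonicalProduct, Real.zero_rpow h0.ne']
  have hr : 0 < ‖z‖ := norm_pos_iff.2 hz
  have hK0 : 0 ≤ K := by simpa using (Nat.cast_nonneg _).trans (hK 1 one_pos)
  refine (norm_canonicalProduct_le_exp_integral h1 hs hz).trans (Real.exp_le_exp.2 ?_)
  have := abs_integral_mul_kern_le (c := 1) (by norm_num) le_rfl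
    (g := fun t => (zeroCount a (‖z‖ * t) : ℝ)) h0 hρ h0 hρ (A := K * ‖z‖ ^ ρ) (B := 0)
    (by positivity) le_rfl (fun t ht => by
      have := hK (‖z‖ * t) (by positivity)
      rw [Real.mul_rpow hr.le ht.le] at this
      rw [abs_of_nonneg (Nat.cast_nonneg _)]
      linarith)
  refine ((le_abs_self _).trans this).trans (le_of_eq ?_)
  ring

/-- The kernel takes both signs, so an inequality for `n` would not suffice: `n(s)` is split as `μ s
^ ρ` plus an error, the first part is bounded below by `le_integral_rpow_kern` and the second is
estimated in absolute value. -/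
theorem le_log_norm_canonicalProduct {a : ℕ → ℝ} (h1 : ∀ n, 1 ≤ a n)
    (hs : Summable fun n => 1 / a n) {K ρ μ ε L c : ℝ} (h0 : 0 < ρ) (hρ : ρ ≤ 1 / 2)
    (hc : -1 < c) (hc1 : c ≤ -(4 / 5)) (hμ : 0 ≤ μ) (hε : 0 ≤ ε) (hL : 0 ≤ L)
    (hK : ∀ s, 0 < s → (zeroCount a s : ℝ) ≤ K * s ^ ρ)
    (hE : ∀ s, 0 < s → |(zeroCount a s : ℝ) - μ * s ^ ρ| ≤ ε * s ^ ρ + L * s ^ (ρ / 2))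
    {z : ℂ} (hz : z ≠ 0) (hre : z.re ≤ -c * ‖z‖) :
    μ * (1 + c) * ‖z‖ ^ ρ - 2 / (1 + c) *
      (ε * (1 / ρ + 2) * ‖z‖ ^ ρ + L * (2 / ρ + 2) * ‖z‖ ^ (ρ / 2)) ≤
        Real.log ‖canonicalProduct a z‖ := by
  have hr : 0 < ‖z‖ := norm_pos_iff.2 hz
  have hc1' : c ≤ 1 := by linarith
  set r := ‖z‖ with hr_def
  have hlow := exp_integral_le_norm_canonicalProduct h1 hs hc hc1' hz hre
  have hlog := (Real.le_log_iff_exp_le ((Real.exp_pos _).trans_le hlow)).2 hlow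
  refine le_trans ?_ hlog
  set ν : ℝ → ℝ := fun t => (zeroCount a (r * t) : ℝ) with hν
  have hmν : Measurable ν := measurable_zeroCount_mul h1 hs hr.le
  have i1 : IntegrableOn (fun t => ν t * (kern c t / t)) (Ioi 0) :=
    integrableOn_mul_kern_div hc hc1' (K := K * r ^ ρ) hmν.aestronglyMeasurable h0 hρ
      fun t ht => by
        have := hK (r * t) (by positivity)
        rw [Real.mul_rpow hr.le ht.le] at this
        rw [abs_of_nonneg (Nat.cast_nonneg _)]
        linarith
  have i2 : IntegrableOn (fun t => t ^ ρ * (kern c t / t)) (Ioi 0) :=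
    integrableOn_mul_kern_div hc hc1' (K := 1)
      (Measurable.aestronglyMeasurable (by fun_prop)) h0 hρ
      fun t ht => by rw [one_mul, abs_of_nonneg (by positivity)]
  have herr := abs_integral_mul_kern_le hc hc1' (g := fun t => ν t - μ * r ^ ρ * t ^ ρ)
    h0 hρ (τ := ρ / 2) (by linarith) (by linarith) (A := ε * r ^ ρ) (B := L * r ^ (ρ / 2))
    (by positivity) (by positivity) fun t ht => by
      have := hE (r * t) (by positivity)
      rw [Real.mul_rpow hr.le ht.le, Real.mul_rpow hr.le ht.le] at this
      simp only [hν]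
      convert this using 1
      · congr 1; ring
      · ring
  have hsplit : ∫ t in Ioi 0, (ν t - μ * r ^ ρ * t ^ ρ) * (kern c t / t) =
      (∫ t in Ioi 0, ν t * (kern c t / t)) -
        μ * r ^ ρ * ∫ t in Ioi 0, t ^ ρ * (kern c t / t) := by
    rw [← integral_const_mul, ← integral_sub i1 (i2.const_mul _)]
    congr 1; funext t; ring
  rw [hsplit] at herr
  have hI := le_integral_rpow_kern hc hc1 h0 hρ
  have hI' := mul_le_mul_of_nonneg_left hI (show 0 ≤ μ * r ^ ρ by positivity)
  have e1 : 1 / (ρ / 2) = 2 / ρ := by field_simp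
  rw [e1] at herr
  have := (abs_le.1 herr).1
  linarith

end

/-! ### Choice of the parameters -/

section

open Set

/-- A number `E` such that the function is at most `4 ^ E` on the relevant disc is
`diskConst d m p * ℓ ^ 2`, where `ℓ` bounds the logarithm of the height. -/
def diskConst (d m p : ℕ) : ℕ := (2 * p + 2 * m + 2) * (2 * p ^ 2 * d) ^ 2

/-- The degree of the auxiliary polynomial is `degreeConst d m p * ℓ ^ 2`. -/
def degreeConst (d m p : ℕ) : ℕ := 1200 * d ^ 4 * diskConst d m p

/-- `radiusConst d m p * ℓ ^ 4` is a lower bound for `r ^ (ρ / 2)` that makes the function large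
at `-r`. -/
def radiusConst (d m p : ℕ) : ℕ :=
  p * (6 * diskConst d m p * degreeConst d m p + 2 * m * degreeConst d m p + p) + 1

/-- The number of points is at most `pointConst d m p * ℓ ^ 10`. -/
def pointConst (d m p : ℕ) : ℕ :=
  4 * ((5 * p + 2 * m + 3) * radiusConst d m p ^ 2) * degreeConst d m p

theorem finite_and_ncard_le {α : Type*} {s : Set α} {n : ℕ}
    (h : ∀ t : Finset α, (t : Set α) ⊆ s → t.card ≤ n) : s.Finite ∧ s.ncard ≤ n := by
  have hf : s.Finite := by
    by_contra hinf
    obtain ⟨t, hts, htc⟩ := (show s.Infinite from hinf).exists_subset_card_eq (n + 1)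
    have := h t hts
    omega
  refine ⟨hf, ?_⟩
  rw [Set.ncard_eq_toFinset_card s hf]
  exact h _ (by simp)

theorem exp_le_four_pow (n : ℕ) : Real.exp n ≤ 4 ^ n := by
  rw [← Real.exp_one_pow]
  have := Real.exp_one_lt_d9
  gcongr
  linarith

theorem log_four_le_two : Real.log 4 ≤ 2 := by
  rw [Real.log_le_iff_le_exp (by norm_num)]
  have h := Real.add_one_le_exp (1 : ℝ)
  have : Real.exp 2 = Real.exp 1 * Real.exp 1 := by rw [← Real.exp_add]; norm_num
  nlinarith

theorem rpow_two_div_le {ρ : ℝ} {m Y : ℕ} (h0 : 0 < ρ) (hm : 1 / (m : ℝ) ≤ ρ) (hm1 : 1 ≤ m)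
    (hY : 1 ≤ Y) : (Y : ℝ) ^ (2 / ρ) ≤ 4 ^ (2 * m * Y) := by
  have hY' : (1 : ℝ) ≤ Y := by exact_mod_cast hY
  have hm' : (0 : ℝ) < m := by exact_mod_cast hm1
  have h1 : 2 / ρ ≤ (2 * m : ℕ) := by
    rw [div_le_iff₀ h0]; push_cast
    rw [div_le_iff₀ hm'] at hm
    nlinarith
  calc (Y : ℝ) ^ (2 / ρ) ≤ (Y : ℝ) ^ ((2 * m : ℕ) : ℝ) :=
        Real.rpow_le_rpow_of_exponent_le hY' h1
    _ = (Y : ℝ) ^ (2 * m) := Real.rpow_natCast _ _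
    _ ≤ (4 ^ Y) ^ (2 * m) := by
        gcongr
        exact_mod_cast (Nat.lt_pow_self (by norm_num)).le
    _ = 4 ^ (2 * m * Y) := by rw [← pow_mul]; congr 1; ring

/-- Since `k ≥ 1` and `ρ ≤ 1/2`, `k ^ ρ ≤ √k ≤ b`: dilating the radius costs a factor that does not
depend on `ρ`. -/
theorem mul_rpow_two_div_rpow {ρ k b : ℝ} {Y : ℕ} (h0 : 0 < ρ) (hρ : ρ ≤ 1 / 2) (hk : 1 ≤ k)
    (hb : 0 ≤ b) (hkb : k ≤ b ^ 2) : (k * (Y : ℝ) ^ (2 / ρ)) ^ ρ ≤ b * (Y : ℝ) ^ 2 := by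
  have hk0 : 0 ≤ k := zero_le_one.trans hk
  rw [Real.mul_rpow hk0 (by positivity), ← Real.rpow_mul (Nat.cast_nonneg Y),
    div_mul_cancel₀ _ h0.ne', Real.rpow_two]
  gcongr
  calc k ^ ρ ≤ k ^ (1 / 2 : ℝ) := Real.rpow_le_rpow_of_exponent_le hk hρ
    _ = √k := (Real.sqrt_eq_rpow k).symm
    _ ≤ b := Real.sqrt_le_iff.2 ⟨hb, hkb⟩

theorem le_of_rpow_half_le {ρ x : ℝ} {Q : ℝ} (h0 : 0 < ρ) (hx : 0 ≤ x) (h : x ^ (ρ / 2) ≤ Q) :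
    x ≤ Q ^ (2 / ρ) := by
  have h1 : x = (x ^ (ρ / 2)) ^ (2 / ρ) := by
    rw [← Real.rpow_mul hx]
    have : ρ / 2 * (2 / ρ) = 1 := by field_simp
    rw [this, Real.rpow_one]
  rw [h1]
  exact Real.rpow_le_rpow (by positivity) h (by positivity)

theorem rpow_half_ge_of_le {ρ x : ℝ} {Q : ℝ} (h0 : 0 < ρ) (hQ : 0 ≤ Q) (h : Q ^ (2 / ρ) ≤ x) :
    Q ≤ x ^ (ρ / 2) := by
  have h1 : Q = (Q ^ (2 / ρ)) ^ (ρ / 2) := by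
    rw [← Real.rpow_mul hQ]
    have : 2 / ρ * (ρ / 2) = 1 := by field_simp
    rw [this, Real.rpow_one]
  rw [h1]
  exact Real.rpow_le_rpow (by positivity) h (by positivity)

theorem rpow_half_sq {ρ x : ℝ} (hx : 0 ≤ x) : (x ^ (ρ / 2)) ^ 2 = x ^ ρ := by
  rw [← Real.rpow_natCast, ← Real.rpow_mul hx]; congr 1; push_cast; ring

/-- Everything is measured in `x = r ^ (ρ / 2)`. In particular `log r ≤ (2 / ρ) log x ≤ 2 * m * x`,
so the threshold for `|f(-r)|` has a logarithm linear in `x`, while the growth of `f` is quadratic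
in `x`. -/
theorem log_one_add_le {ρ r : ℝ} {E T m : ℕ} (hm : 1 ≤ m) (hE1 : 1 ≤ E) (hT1 : 1 ≤ T) (h0 : 0 < ρ)
    (hmρ : 1 / (m : ℝ) ≤ ρ) (hr1 : 1 ≤ r) :
    Real.log (1 + T * 4 ^ (E * T) * r ^ T) ≤ (6 * E * T + 2 * m * T) * r ^ (ρ / 2) := by
  have hr0 : 0 < r := by linarith
  have hm' : (0 : ℝ) < m := by exact_mod_cast hm
  obtain ⟨x, hx⟩ : ∃ x : ℝ, x = r ^ (ρ / 2) := ⟨_, rfl⟩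
  have hx1 : 1 ≤ x := by rw [hx]; exact Real.one_le_rpow hr1 (by positivity)
  obtain ⟨V, hV⟩ : ∃ V : ℝ, V = 1 + T * 4 ^ (E * T) * r ^ T := ⟨_, rfl⟩
  have hV1 : 1 ≤ V := by rw [hV]; exact le_add_of_nonneg_right (by positivity)
  have hEET : E ≤ E * T := Nat.le_mul_of_pos_right _ hT1
  have hTET : T ≤ E * T := Nat.le_mul_of_pos_left _ hE1
  rw [← hV, ← hx]
  have hlogr : Real.log r ≤ 2 * m * x := by
    have h1 : r ≤ x ^ (2 / ρ) := le_of_rpow_half_le h0 hr0.le hx.ge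
    have h2 : Real.log r ≤ 2 / ρ * Real.log x := by
      rw [← Real.log_rpow (by positivity)]; exact Real.log_le_log hr0 h1
    have h3 : 2 / ρ ≤ 2 * m := by
      rw [div_le_iff₀ h0]
      rw [div_le_iff₀ (by positivity)] at hmρ
      nlinarith
    calc Real.log r ≤ 2 / ρ * Real.log x := h2
      _ ≤ 2 * m * x := by
        gcongr
        · exact Real.log_nonneg hx1
        · exact Real.log_le_self (by linarith)
  have h1 : V ≤ 4 ^ (1 + T + E * T) * r ^ T := by
    have hT4 : (T : ℝ) ≤ 4 ^ T := by exact_mod_cast (Nat.lt_pow_self (by norm_num)).le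
    have hrT : (1 : ℝ) ≤ r ^ T := one_le_pow₀ hr1
    have hA1 : (1 : ℝ) ≤ 4 ^ T * 4 ^ (E * T) * r ^ T :=
      one_le_mul_of_one_le_of_one_le (one_le_mul_of_one_le_of_one_le
        (one_le_pow₀ (by norm_num)) (one_le_pow₀ (by norm_num))) hrT
    have hA2 : T * 4 ^ (E * T) * r ^ T ≤ 4 ^ T * 4 ^ (E * T) * r ^ T := by
      gcongr
    have e : (4 : ℝ) ^ (1 + T + E * T) = 4 * (4 ^ T * 4 ^ (E * T)) := by
      rw [pow_add, pow_add, pow_one]; ring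
    rw [e, hV]
    linarith
  have h2 : Real.log V ≤ (1 + T + E * T : ℕ) * Real.log 4 + T * Real.log r := by
    rw [← Real.log_pow, ← Real.log_pow, ← Real.log_mul (by positivity) (by positivity)]
    exact Real.log_le_log (by positivity) h1
  have h3 : ((1 + T + E * T : ℕ) : ℝ) ≤ 3 * E * T := by
    have : 1 + T + E * T ≤ 3 * E * T := by rw [mul_assoc]; nlinarith
    exact_mod_cast this
  calc Real.log V ≤ (1 + T + E * T : ℕ) * Real.log 4 + T * Real.log r := h2
    _ ≤ 3 * E * T * 2 + T * (2 * m * x) := by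
        gcongr
        exact log_four_le_two
    _ ≤ 6 * E * T * x + 2 * m * T * x := by
        have : (6 * E * T : ℝ) ≤ 6 * E * T * x := le_mul_of_one_le_right (by positivity) hx1
        linarith
    _ = _ := by ring

theorem le_norm_of_growth {f : ℂ → ℂ} {φ ρ : ℝ} {E T m p r : ℕ} (hm : 1 ≤ m) (hE1 : 1 ≤ E)
    (hT1 : 1 ≤ T) (h0 : 0 < ρ) (hmρ : 1 / (m : ℝ) ≤ ρ) (hφ : φ < Real.pi) (hr1 : (1 : ℝ) ≤ r)
    (hr : (p : ℝ) * (6 * E * T + 2 * m * T + p) + 1 ≤ (r : ℝ) ^ (ρ / 2))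
    (hL : ∀ z ∉ sector φ, ∀ y : ℝ, 0 ≤ y → Real.log ‖f z‖ ≤ y →
      ‖z‖ ^ ρ ≤ p * (y + p * ‖z‖ ^ (ρ / 2))) :
    1 + T * 4 ^ (E * T) * (r : ℝ) ^ T ≤ ‖f (-(r : ℂ))‖ := by
  have hr0 : (0 : ℝ) < r := by linarith
  have hlogV := log_one_add_le hm hE1 hT1 h0 hmρ hr1
  obtain ⟨x, hx⟩ : ∃ x : ℝ, x = (r : ℝ) ^ (ρ / 2) := ⟨_, rfl⟩
  obtain ⟨V, hV⟩ : ∃ V : ℝ, V = 1 + T * 4 ^ (E * T) * (r : ℝ) ^ T := ⟨_, rfl⟩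
  rw [← hV, ← hx] at hlogV
  rw [← hV]
  rw [← hx] at hr
  have hx0 : 0 < x := by rw [hx]; positivity
  have hns : (-(r : ℂ)) ∉ sector φ := by
    intro h
    have harg : (-(r : ℂ)).arg = Real.pi := by
      have : (-(r : ℂ)) = ((-(r : ℝ) : ℝ) : ℂ) := by push_cast; rfl
      rw [this, Complex.arg_ofReal_of_neg (by linarith)]
    have := h.2
    rw [harg] at this
    linarith
  have hnorm : ‖(-(r : ℂ))‖ = r := by rw [norm_neg, Complex.norm_natCast]
  have hV1 : 1 ≤ V := by rw [hV]; exact le_add_of_nonneg_right (by positivity)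
  -- If `|f(-r)|` were below the threshold, the growth hypothesis would give `x ^ 2 ≤ p * (6ET + 2mT
  -- + p) * x`, against the lower bound on `x`.
  by_contra! hlt
  have hlogf : Real.log ‖f (-(r : ℂ))‖ ≤ Real.log V := by
    rcases (norm_nonneg (f (-(r : ℂ)))).eq_or_lt with h | h
    · rw [← h, Real.log_zero]; exact Real.log_nonneg hV1
    · exact Real.log_le_log h hlt.le
  have key := hL _ hns _ (Real.log_nonneg hV1) hlogf
  rw [hnorm, ← rpow_half_sq hr0.le, ← hx] at key
  have h5 : x ^ 2 ≤ p * ((6 * E * T + 2 * m * T) * x + p * x) := by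
    refine key.trans ?_
    gcongr
  nlinarith

/-- Localisation of the counted points: `|f(z)| ≤ H ^ d` gives `log |f(z)| ≤ d * ℓ`, and the growth
hypothesis becomes `x ^ 2 ≤ p * d * ℓ + p ^ 2 * x` for `x = ‖z‖ ^ (ρ / 2)`, which bounds `x`. -/
theorem rpow_half_le_of_growth {f : ℂ → ℂ} {φ ρ H : ℝ} {d p ℓ : ℕ} {z : ℂ} (hd : 1 ≤ d)
    (hp : 1 ≤ p) (hℓ : 1 ≤ ℓ) (hH : 1 ≤ H) (hHℓ : Real.log H ≤ ℓ)
    (hL : ∀ z ∉ sector φ, ∀ y : ℝ, 0 ≤ y → Real.log ‖f z‖ ≤ y →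
      ‖z‖ ^ ρ ≤ p * (y + p * ‖z‖ ^ (ρ / 2)))
    (hzs : z ∉ sector φ) (hdeg : DegreeLE d z (f z)) (hht : height₂ z (f z) ≤ H) :
    ‖z‖ ^ (ρ / 2) ≤ (2 * p ^ 2 * d * ℓ : ℕ) := by
  obtain ⟨Q, hQ⟩ : ∃ Q : ℕ, Q = 2 * p ^ 2 * d * ℓ := ⟨_, rfl⟩
  have hQ1' : (1 : ℝ) ≤ Q := by
    have : 1 ≤ Q := by rw [hQ]; exact Nat.succ_le_of_lt (by positivity)
    exact_mod_cast this
  rw [← hQ]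
  have hfz := hdeg.norm_right_le hH ((le_max_right _ _).trans hht)
  have hlog : Real.log ‖f z‖ ≤ d * ℓ := by
    rcases (norm_nonneg (f z)).eq_or_lt with h | h
    · rw [← h, Real.log_zero]; positivity
    · refine (Real.log_le_log h hfz).trans ?_
      rw [Real.log_pow]; gcongr
  have key := hL z hzs _ (by positivity) hlog
  rw [← rpow_half_sq (norm_nonneg _)] at key
  set x := ‖z‖ ^ (ρ / 2)
  by_contra! hlt
  have hx1 : 1 ≤ x := hQ1'.trans hlt.le
  have hp' : (1 : ℝ) ≤ p := by exact_mod_cast hp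
  have hdℓ : (1 : ℝ) ≤ d * ℓ := by exact_mod_cast Nat.mul_pos hd hℓ
  have e : (Q : ℝ) = 2 * p ^ 2 * (d * ℓ) := by rw [hQ]; push_cast; ring
  have h1 : (p : ℝ) * (d * ℓ) ≤ p ^ 2 * (d * ℓ) * x := by
    have : (p : ℝ) ≤ p ^ 2 * x := by nlinarith [mul_le_mul hp' hx1 (by norm_num) (by linarith)]
    nlinarith
  have h2 : (p : ℝ) * (p * x) ≤ p ^ 2 * (d * ℓ) * x := by
    have : (p : ℝ) ^ 2 * x ≤ p ^ 2 * x * (d * ℓ) := le_mul_of_one_le_right (by positivity) hdℓ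
    linarith
  have h3 : x ^ 2 ≤ Q * x := by rw [e]; linarith
  nlinarith

/-- The number of algebraic points on the graph of an entire function with regular growth. -/
theorem algPoints_bound_of_growth {f : ℂ → ℂ} (hf : Differentiable ℂ f) {φ ρ H : ℝ}
    {d m p ℓ : ℕ} (hd : 1 ≤ d) (hm : 1 ≤ m) (hp : 1 ≤ p) (hℓ : 1 ≤ ℓ) (h0 : 0 < ρ)
    (hmρ : 1 / (m : ℝ) ≤ ρ) (hρ : ρ ≤ 1 / 2) (hφ : φ < Real.pi) (hH : 1 ≤ H)
    (hHℓ : Real.log H ≤ ℓ) (hU : ∀ z, ‖f z‖ ≤ Real.exp (p * ‖z‖ ^ ρ))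
    (hL : ∀ z ∉ sector φ, ∀ y : ℝ, 0 ≤ y → Real.log ‖f z‖ ≤ y →
      ‖z‖ ^ ρ ≤ p * (y + p * ‖z‖ ^ (ρ / 2))) :
    (algPoints f φ d H).Finite ∧ (algPoints f φ d H).ncard ≤ pointConst d m p * ℓ ^ 10 := by
  -- For fixed `d`, `m`, `p` the orders in `ℓ` are: `Q` is `ℓ`, `E` and `T` are `ℓ ^ 2`, `Y` is `E *
  -- T`, that is `ℓ ^ 4`, and `U` is `Y ^ 2`, that is `ℓ ^ 8`. Hence `4 * U * T` has order `ℓ ^ 10`.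
  -- The radii below are `Q ^ (2 / ρ)` for the counted points and `Y ^ (2 / ρ)` for the Jensen
  -- centre.
  obtain ⟨Q, hQ⟩ : ∃ Q : ℕ, Q = 2 * p ^ 2 * d * ℓ := ⟨_, rfl⟩
  obtain ⟨E, hE⟩ : ∃ E : ℕ, E = diskConst d m p * ℓ ^ 2 := ⟨_, rfl⟩
  obtain ⟨T, hT⟩ : ∃ T : ℕ, T = degreeConst d m p * ℓ ^ 2 := ⟨_, rfl⟩
  obtain ⟨Y, hY⟩ : ∃ Y : ℕ, Y = radiusConst d m p * ℓ ^ 4 := ⟨_, rfl⟩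
  obtain ⟨U, hUdef⟩ : ∃ U : ℕ, U = (5 * p + 2 * m + 3) * Y ^ 2 := ⟨_, rfl⟩
  have hQ1 : 1 ≤ Q := by rw [hQ]; exact Nat.succ_le_of_lt (by positivity)
  have hEQ : E = (2 * p + 2 * m + 2) * Q ^ 2 := by rw [hE, hQ, diskConst]; ring
  have hQQ : Q ≤ Q ^ 2 := Nat.le_self_pow (by norm_num) Q
  have hℓQ : ℓ ≤ Q := by rw [hQ]; exact Nat.le_mul_of_pos_left _ (by positivity)
  have hE1 : 1 ≤ E := by rw [hEQ]; exact Nat.succ_le_of_lt (by positivity)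
  have hQE : Q ≤ E := hQQ.trans (by rw [hEQ]; exact Nat.le_mul_of_pos_left _ (by positivity))
  have hTE : T = 1200 * d ^ 4 * E := by rw [hT, hE, degreeConst]; ring
  have hT1 : 1 ≤ T := by rw [hTE]; exact Nat.succ_le_of_lt (by positivity)
  have hYlow : p * (6 * E * T + 2 * m * T + p) + 1 ≤ Y := by
    have hℓ2 : ℓ ^ 2 ≤ ℓ ^ 4 := Nat.pow_le_pow_right hℓ (by norm_num)
    have hℓ4 : 1 ≤ ℓ ^ 4 := Nat.one_le_pow _ _ hℓ
    have e : Y = p * (6 * diskConst d m p * degreeConst d m p * ℓ ^ 4 +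
        2 * m * degreeConst d m p * ℓ ^ 4 + p * ℓ ^ 4) + ℓ ^ 4 := by
      rw [hY, radiusConst]; ring
    rw [e]
    have e1 : 6 * E * T = 6 * diskConst d m p * degreeConst d m p * ℓ ^ 4 := by
      rw [hE, hT]; ring
    have e2 : 2 * m * T ≤ 2 * m * degreeConst d m p * ℓ ^ 4 := by
      rw [hT, mul_assoc (2 * m)]; gcongr
    have e3 : p ≤ p * ℓ ^ 4 := Nat.le_mul_of_pos_right _ hℓ4
    rw [e1]
    gcongr
  have hETY : 6 * E * T ≤ Y := by
    have : 6 * E * T + 2 * m * T + p ≤ p * (6 * E * T + 2 * m * T + p) :=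
      Nat.le_mul_of_pos_left _ hp
    omega
  have hEET : E ≤ E * T := Nat.le_mul_of_pos_right _ hT1
  have hTET : T ≤ E * T := Nat.le_mul_of_pos_left _ hE1
  have hEY : E ≤ Y := by rw [mul_assoc] at hETY; omega
  have hTY : T ≤ Y := by rw [mul_assoc] at hETY; omega
  have hY1 : 1 ≤ Y := hE1.trans hEY
  have hYY : Y ≤ Y ^ 2 := Nat.le_self_pow (by norm_num) Y
  have hEU : E ≤ U := hEY.trans (hYY.trans (by
    rw [hUdef]; exact Nat.le_mul_of_pos_left _ (by positivity)))
  set R : ℝ := (Q : ℝ) ^ (2 / ρ) with hR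
  set W : ℝ := (Y : ℝ) ^ (2 / ρ) with hW
  have hY1' : (1 : ℝ) ≤ Y := by exact_mod_cast hY1
  have hQ1' : (1 : ℝ) ≤ Q := by exact_mod_cast hQ1
  have h2ρ : 1 ≤ 2 / ρ := by rw [le_div_iff₀ h0]; linarith
  have hR0 : 0 < R := by positivity
  have hYW : (Y : ℝ) ≤ W := by
    have := Real.rpow_le_rpow_of_exponent_le hY1' h2ρ
    rwa [Real.rpow_one] at this
  have hRW : R ≤ W := by
    apply Real.rpow_le_rpow (by positivity) _ (by positivity)
    exact_mod_cast hQE.trans hEY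
  have hexp : ∀ (z : ℂ) (k : ℝ) (n : ℕ), ‖z‖ ^ ρ ≤ k → p * k ≤ n → ‖f z‖ ≤ 4 ^ n := by
    intro z k n hz hk
    refine (hU z).trans ((Real.exp_le_exp.2 ?_).trans (exp_le_four_pow n))
    refine le_trans ?_ hk
    gcongr
  have hH0 : 0 < H := one_pos.trans_le hH
  have hcount : ∀ S : Finset ℂ, (S : Set ℂ) ⊆ algPoints f φ d H → S.card ≤ 4 * U * T := by
    intro S hS
    -- `s = 4 * W` suffices: `⌈W⌉₊ ≤ W + 1`, and `1`, `T` and `R` are each at most `W`.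
    refine card_points_le hf (E := E) (r₀ := ⌈W⌉₊) (R := R) (H := H) (s := 4 * W) hd hE1 hEU
      ?_ hR0 hH ?_ ?_ ?_ hTE ?_ ?_ ?_ ?_ S ?_
    · exact Nat.one_le_iff_ne_zero.2 (Nat.ceil_pos.2 (by positivity)).ne'
    · calc H = Real.exp (Real.log H) := (Real.exp_log hH0).symm
        _ ≤ Real.exp ℓ := Real.exp_le_exp.2 hHℓ
        _ ≤ 4 ^ ℓ := exp_le_four_pow ℓ
        _ ≤ 4 ^ E := pow_le_pow_right₀ (by norm_num) (hℓQ.trans hQE)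
    · calc 4 * R ≤ 4 * 4 ^ (2 * m * Q) := by
            gcongr; exact rpow_two_div_le h0 hmρ hm hQ1
        _ = 4 ^ (2 * m * Q + 1) := by rw [pow_succ]; ring
        _ ≤ 4 ^ E := by
            refine pow_le_pow_right₀ (by norm_num) ?_
            have := Nat.mul_le_mul_left (2 * m) hQQ
            rw [hEQ, add_mul, add_mul]; omega
    · intro z hz
      -- The factor `2` is `√4`, for the circle of radius `4 * R`; on the disc of radius `24 * W` it
      -- becomes `5 ≥ √24`.
      refine hexp z (2 * (Q : ℝ) ^ 2) E ?_ ?_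
      · rw [hz]; exact mul_rpow_two_div_rpow h0 hρ (by norm_num) (by norm_num) (by norm_num)
      · have : p * (2 * Q ^ 2) ≤ E := by
          rw [hEQ, ← mul_assoc]; exact Nat.mul_le_mul_right _ (by omega)
        exact_mod_cast this
    · intro r hr _
      have hWr : W ≤ r := (Nat.le_ceil W).trans (by exact_mod_cast hr)
      exact le_norm_of_growth hm hE1 hT1 h0 hmρ hφ (hY1'.trans (hYW.trans hWr))
        ((show (p : ℝ) * (6 * E * T + 2 * m * T + p) + 1 ≤ Y by exact_mod_cast hYlow).trans
          (rpow_half_ge_of_le h0 (by positivity) hWr)) hL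
    · have h1 : (⌈W⌉₊ : ℝ) < W + 1 := Nat.ceil_lt_add_one (by positivity)
      have h2 : (T : ℝ) ≤ W := le_trans (by exact_mod_cast hTY) hYW
      linarith
    · calc 6 * (4 * W) = 24 * W := by ring
        _ ≤ 4 ^ 3 * 4 ^ (2 * m * Y) := by
            gcongr
            · norm_num
            · exact rpow_two_div_le h0 hmρ hm hY1
        _ = 4 ^ (2 * m * Y + 3) := by rw [← pow_add]; congr 1; ring
        _ ≤ 4 ^ U := by
            refine pow_le_pow_right₀ (by norm_num) ?_
            have := Nat.mul_le_mul_left (2 * m) hYY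
            rw [hUdef, add_mul, add_mul]; omega
    · intro z hz
      refine hexp z (5 * (Y : ℝ) ^ 2) U ?_ ?_
      · refine (Real.rpow_le_rpow (norm_nonneg _) hz h0.le).trans ?_
        rw [← mul_assoc]
        exact mul_rpow_two_div_rpow h0 hρ (by norm_num) (by norm_num) (by norm_num)
      · have : p * (5 * Y ^ 2) ≤ U := by
          rw [hUdef, ← mul_assoc]; exact Nat.mul_le_mul_right _ (by omega)
        exact_mod_cast this
    · intro z hz
      obtain ⟨hzs, hdeg, hht⟩ := hS hz
      exact ⟨le_of_rpow_half_le h0 (norm_nonneg _)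
        (by rw [hQ]; exact rpow_half_le_of_growth hd hp hℓ hH hHℓ hL hzs hdeg hht), hdeg, hht⟩
  have hfin := finite_and_ncard_le hcount
  refine ⟨hfin.1, hfin.2.trans (le_of_eq ?_)⟩
  rw [hUdef, hT, hY, pointConst]; ring

end

/-! ### Explicit growth constants from the density of zeros -/

section

open Set

/-- `n(r) ≤ countConst m r₁ * r ^ ρ` for all `r > 0`. -/
def countConst (m r₁ : ℕ) : ℕ := (m + 1) * (r₁ + 1)

/-- `|n(r) - μ r ^ ρ|` is at most `ε r ^ ρ + errorConst m r₁ * r ^ (ρ / 2)` for all `r > 0`. -/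
def errorConst (m r₁ : ℕ) : ℕ := (countConst m r₁ + m) * (r₁ + 1)

/-- The constant that governs the growth of the canonical product. -/
def growthConst (m r₁ : ℕ) : ℕ := 1000 * m ^ 6 * errorConst m r₁

/-- The precision to which `n(r) / r ^ ρ` has to be known. -/
def precision (m : ℕ) : ℕ := 100 * m ^ 5 * (m + 2)

theorem zeroCount_le_mul_rpow {a : ℕ → ℝ} (h1 : ∀ n, 1 ≤ a n) (hs : Summable fun n => 1 / a n)
    {ρ μ ε : ℝ} {m r₁ : ℕ} (h0 : 0 < ρ) (hρ : ρ ≤ 1 / 2) (hμm : μ ≤ m) (hε1 : ε ≤ 1)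
    (hr₁ : ∀ r : ℝ, (r₁ : ℝ) ≤ r → |(zeroCount a r : ℝ) / r ^ ρ - μ| ≤ ε) {s : ℝ} (hs0 : 0 < s) :
    (zeroCount a s : ℝ) ≤ countConst m r₁ * s ^ ρ := by
  have hlarge : ∀ r : ℝ, 0 < r → (r₁ : ℝ) ≤ r → (zeroCount a r : ℝ) ≤ (m + 1) * r ^ ρ := by
    intro r hr hrr
    have := (abs_le.1 (hr₁ r hrr)).2
    have h2 : (zeroCount a r : ℝ) / r ^ ρ ≤ m + 1 := by linarith
    rwa [div_le_iff₀ (by positivity)] at h2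
  have hr10 : (0 : ℝ) ≤ r₁ := Nat.cast_nonneg _
  rw [countConst]; push_cast
  rcases le_or_gt (r₁ : ℝ) s with h | h
  · refine (hlarge s hs0 h).trans ?_
    gcongr
    exact le_mul_of_one_le_right (by positivity) (by linarith)
  · rcases le_or_gt s 1 with h' | h'
    · rw [zeroCount_eq_zero h1 h']; push_cast; positivity
    · have hr1 : (1 : ℝ) < r₁ := h'.trans h
      have e1 : (zeroCount a s : ℝ) ≤ zeroCount a r₁ := by
        exact_mod_cast zeroCount_mono h1 hs h.le
      have e2 : (r₁ : ℝ) ^ ρ ≤ r₁ := Real.rpow_le_self_of_one_le hr1.le (by linarith)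
      have e3 : 1 ≤ s ^ ρ := Real.one_le_rpow h'.le h0.le
      calc (zeroCount a s : ℝ) ≤ (m + 1) * (r₁ : ℝ) ^ ρ :=
            e1.trans (hlarge r₁ (by linarith) le_rfl)
        _ ≤ (m + 1) * (r₁ + 1) := by gcongr; linarith
        _ ≤ (m + 1) * (r₁ + 1) * s ^ ρ := le_mul_of_one_le_right (by positivity) e3

/-- Below `r₁` nothing is known about the density, and there `s ^ ρ ≤ (r₁ + 1) * s ^ (ρ / 2)`. A
bounded error would not be integrable against `dt / t` at `0`; the power `ρ / 2` is, and it is still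
of lower order than the main term. -/
theorem abs_zeroCount_sub_le {a : ℕ → ℝ} (h1 : ∀ n, 1 ≤ a n) (hs : Summable fun n => 1 / a n)
    {ρ μ ε : ℝ} {m r₁ : ℕ} (h0 : 0 < ρ) (hρ : ρ ≤ 1 / 2) (hμ0 : 0 ≤ μ) (hμm : μ ≤ m)
    (hε0 : 0 ≤ ε) (hε1 : ε ≤ 1)
    (hr₁ : ∀ r : ℝ, (r₁ : ℝ) ≤ r → |(zeroCount a r : ℝ) / r ^ ρ - μ| ≤ ε) {s : ℝ} (hs0 : 0 < s) :
    |(zeroCount a s : ℝ) - μ * s ^ ρ| ≤ ε * s ^ ρ + errorConst m r₁ * s ^ (ρ / 2) := by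
  have hsρ : 0 < s ^ ρ := by positivity
  have hK := zeroCount_le_mul_rpow h1 hs h0 hρ hμm hε1 hr₁ hs0
  rcases le_or_gt (r₁ : ℝ) s with h | h
  · have h2 := hr₁ s h
    have e : (zeroCount a s : ℝ) - μ * s ^ ρ = ((zeroCount a s : ℝ) / s ^ ρ - μ) * s ^ ρ := by
      field_simp
    rw [e, abs_mul, abs_of_pos hsρ]
    have : 0 ≤ (errorConst m r₁ : ℝ) * s ^ (ρ / 2) := by positivity
    have := mul_le_mul_of_nonneg_right h2 hsρ.le
    linarith
  · have e1 : |(zeroCount a s : ℝ) - μ * s ^ ρ| ≤ (countConst m r₁ + m) * s ^ ρ := by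
      have h3 : μ * s ^ ρ ≤ m * s ^ ρ := by gcongr
      have h4 : 0 ≤ μ * s ^ ρ := by positivity
      have h5 : (0 : ℝ) ≤ zeroCount a s := Nat.cast_nonneg _
      have h6 : 0 ≤ (countConst m r₁ : ℝ) * s ^ ρ := by positivity
      have h7 : 0 ≤ (m : ℝ) * s ^ ρ := by positivity
      rw [abs_le]; constructor <;> linarith
    have e2 : s ^ (ρ / 2) ≤ r₁ + 1 := by
      have : (1 : ℝ) ≤ r₁ + 1 := by linarith [(Nat.cast_nonneg r₁ : (0 : ℝ) ≤ r₁)]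
      exact (Real.rpow_le_rpow hs0.le (by linarith) (by linarith)).trans
        (Real.rpow_le_self_of_one_le this (by linarith))
    have e3 : (countConst m r₁ + m) * s ^ ρ ≤ errorConst m r₁ * s ^ (ρ / 2) := by
      rw [← rpow_half_sq hs0.le, errorConst]; push_cast
      calc ((countConst m r₁ : ℝ) + m) * (s ^ (ρ / 2)) ^ 2
          = (countConst m r₁ + m) * s ^ (ρ / 2) * s ^ (ρ / 2) := by ring
        _ ≤ (countConst m r₁ + m) * (r₁ + 1) * s ^ (ρ / 2) := by gcongr
    have : 0 ≤ ε * s ^ ρ := by positivity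
    linarith

/-- From `cos θ ≤ 1 - (2 / π²) θ²` with `|θ| ≥ 1 / m`, and `2 / π² ≥ 1 / 5`. -/
theorem re_le_of_notMem_sector {φ : ℝ} {m : ℕ} (hm : 1 ≤ m) (hφm : 1 / (m : ℝ) ≤ φ) {z : ℂ}
    (hz : z ∉ sector φ) : z.re ≤ -(-1 + 1 / (5 * (m : ℝ) ^ 2)) * ‖z‖ := by
  have hm0 : (0 : ℝ) < m := by exact_mod_cast hm
  have harg : 1 / (m : ℝ) ≤ |z.arg| := by
    by_contra! h
    refine hz ⟨?_, ?_⟩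
    · linarith [neg_abs_le z.arg]
    · linarith [le_abs_self z.arg]
  have hcos : Real.cos z.arg ≤ 1 - 1 / (5 * (m : ℝ) ^ 2) := by
    have h1 := Real.cos_le_one_sub_mul_cos_sq (Complex.abs_arg_le_pi z)
    have hpi : Real.pi ^ 2 ≤ 10 := by nlinarith [Real.pi_lt_d2, Real.pi_pos]
    have h2 : 1 / (m : ℝ) ^ 2 ≤ z.arg ^ 2 := by
      rw [← sq_abs z.arg, ← one_div_pow]; gcongr
    have h3 : 1 / 5 ≤ 2 / Real.pi ^ 2 := by
      rw [div_le_div_iff₀ (by norm_num) (by positivity)]; linarith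
    have h4 : 1 / (5 * (m : ℝ) ^ 2) ≤ 2 / Real.pi ^ 2 * z.arg ^ 2 := by
      rw [show 1 / (5 * (m : ℝ) ^ 2) = 1 / 5 * (1 / (m : ℝ) ^ 2) by field_simp]
      gcongr
    linarith
  have hre : z.re = ‖z‖ * Real.cos z.arg := (Complex.norm_mul_cos_arg z).symm
  rw [hre]
  nlinarith [norm_nonneg z, mul_le_mul_of_nonneg_left hcos (norm_nonneg z)]

theorem norm_canonicalProduct_le_growthConst {a : ℕ → ℝ} (h1 : ∀ n, 1 ≤ a n)
    (hs : Summable fun n => 1 / a n) {ρ μ ε : ℝ} {m r₁ : ℕ} (hm : 1 ≤ m)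
    (hmρ : 1 / (m : ℝ) ≤ ρ) (hρ : ρ ≤ 1 / 2) (hμm : μ ≤ m) (hε1 : ε ≤ 1)
    (hr₁ : ∀ r : ℝ, (r₁ : ℝ) ≤ r → |(zeroCount a r : ℝ) / r ^ ρ - μ| ≤ ε) (z : ℂ) :
    ‖canonicalProduct a z‖ ≤ Real.exp (growthConst m r₁ * ‖z‖ ^ ρ) := by
  have hm0 : (0 : ℝ) < m := by exact_mod_cast hm
  have h0 : 0 < ρ := lt_of_lt_of_le (by positivity) hmρ
  refine (norm_canonicalProduct_le h1 hs h0 hρ (K := countConst m r₁)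
    (fun s hs0 => zeroCount_le_mul_rpow h1 hs h0 hρ hμm hε1 hr₁ hs0) z).trans
    (Real.exp_le_exp.2 ?_)
  gcongr
  have e1 : 1 / ρ ≤ m := by rw [div_le_iff₀ h0]; rwa [div_le_iff₀ hm0, mul_comm] at hmρ
  have e2 : countConst m r₁ * (m + 2) ≤ growthConst m r₁ := by
    have h3 : countConst m r₁ ≤ errorConst m r₁ :=
      (Nat.le_add_right _ _).trans (Nat.le_mul_of_pos_right _ (Nat.succ_pos _))
    have h4 : m ≤ m ^ 6 := Nat.le_self_pow (by norm_num) m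
    calc countConst m r₁ * (m + 2) ≤ errorConst m r₁ * (1000 * m ^ 6) := by gcongr; omega
      _ = growthConst m r₁ := by rw [growthConst]; ring
  calc (countConst m r₁ : ℝ) * (1 / ρ + 2) ≤ countConst m r₁ * (m + 2) := by gcongr
    _ ≤ growthConst m r₁ := by exact_mod_cast e2

/-- The lower bound for `log |f|` solved for `‖z‖ ^ ρ`. With `1 + c = 1 / (5 m²)` the main term has
coefficient at least `1 / (5 m³)`, and `precision m` is chosen so that the density error takes at
most half of it. -/
theorem rpow_le_of_log_norm_le {a : ℕ → ℝ} (h1 : ∀ n, 1 ≤ a n)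
    (hs : Summable fun n => 1 / a n) {φ ρ μ : ℝ} {m r₁ : ℕ} (hm : 1 ≤ m)
    (hmρ : 1 / (m : ℝ) ≤ ρ) (hρ : ρ ≤ 1 / 2) (hφ0 : 0 < φ) (hφm : 1 / (m : ℝ) ≤ φ)
    (hmμ : 1 / (m : ℝ) ≤ μ) (hμm : μ ≤ m)
    (hr₁ : ∀ r : ℝ, (r₁ : ℝ) ≤ r →
      |(zeroCount a r : ℝ) / r ^ ρ - μ| ≤ 1 / ((precision m : ℝ) + 1))
    {z : ℂ} (hz : z ∉ sector φ) {y : ℝ} (hy0 : 0 ≤ y)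
    (hy : Real.log ‖canonicalProduct a z‖ ≤ y) :
    ‖z‖ ^ ρ ≤ growthConst m r₁ * (y + growthConst m r₁ * ‖z‖ ^ (ρ / 2)) := by
  have hm1 : (1 : ℝ) ≤ m := by exact_mod_cast hm
  have hm0 : (0 : ℝ) < m := by linarith
  have h0 : 0 < ρ := lt_of_lt_of_le (by positivity) hmρ
  have hμ0 : 0 < μ := lt_of_lt_of_le (by positivity) hmμ
  have hz0 : z ≠ 0 := by
    rintro rfl; exact hz ⟨by simpa using hφ0.le, by simpa using hφ0.le⟩
  have hε0 : 0 ≤ 1 / ((precision m : ℝ) + 1) := by positivity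
  have hε1 : 1 / ((precision m : ℝ) + 1) ≤ 1 := by
    rw [div_le_one (by positivity)]; linarith [(Nat.cast_nonneg (precision m) : (0 : ℝ) ≤ _)]
  have hδ : 1 / (5 * (m : ℝ) ^ 2) ≤ 1 / 5 :=
    one_div_le_one_div_of_le (by norm_num) (by nlinarith)
  have hδ0 : 0 < 1 / (5 * (m : ℝ) ^ 2) := by positivity
  have key := le_log_norm_canonicalProduct h1 hs (c := -1 + 1 / (5 * (m : ℝ) ^ 2))
    (L := errorConst m r₁) (K := countConst m r₁) h0 hρ (by linarith) (by linarith) hμ0.le hε0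
    (Nat.cast_nonneg _)
    (fun s hs0 => zeroCount_le_mul_rpow h1 hs h0 hρ hμm hε1 hr₁ hs0)
    (fun s hs0 => abs_zeroCount_sub_le h1 hs h0 hρ hμ0.le hμm hε0 hε1 hr₁ hs0) hz0
    (re_le_of_notMem_sector hm hφm hz)
  obtain ⟨x, hx⟩ : ∃ x, x = ‖z‖ ^ ρ := ⟨_, rfl⟩
  obtain ⟨w, hw⟩ : ∃ w, w = ‖z‖ ^ (ρ / 2) := ⟨_, rfl⟩
  obtain ⟨L, hL⟩ : ∃ L : ℝ, L = errorConst m r₁ := ⟨_, rfl⟩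
  have hx0 : 0 ≤ x := by rw [hx]; positivity
  have hw0 : 0 ≤ w := by rw [hw]; positivity
  have hL1 : 1 ≤ L := by
    have : 1 ≤ errorConst m r₁ := Nat.mul_pos (by omega) (Nat.succ_pos _)
    rw [hL]; exact_mod_cast this
  have hG : (growthConst m r₁ : ℝ) = 1000 * m ^ 6 * L := by rw [hL, growthConst]; push_cast; ring
  have hP : (precision m : ℝ) = 100 * m ^ 5 * (m + 2) := by rw [precision]; push_cast; ring
  rw [← hx, ← hw, ← hL, hP] at key
  rw [hG, ← hx, ← hw]
  have e1 : 1 / ρ ≤ m := by rw [div_le_iff₀ h0]; rwa [div_le_iff₀ hm0, mul_comm] at hmρ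
  have e1' : 2 / ρ ≤ 2 * m := by
    have : 2 / ρ = 2 * (1 / ρ) := by ring
    rw [this]; linarith
  have e2 : 1 + (-1 + 1 / (5 * (m : ℝ) ^ 2)) = 1 / (5 * (m : ℝ) ^ 2) := by ring
  have e3 : 2 / (1 / (5 * (m : ℝ) ^ 2)) = 10 * m ^ 2 := by field_simp; norm_num
  rw [e2, e3] at key
  -- The factor `m + 2` in `precision` cancels `1 / ρ + 2`; the remaining `100 * m ^ 5`, against the
  -- factor `10 * m ^ 2` in front, leaves an error `1 / (10 m³)`.
  have e4 : 1 / (100 * (m : ℝ) ^ 5 * (m + 2) + 1) * (1 / ρ + 2) ≤ 1 / (100 * (m : ℝ) ^ 5) := by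
    calc 1 / (100 * (m : ℝ) ^ 5 * (m + 2) + 1) * (1 / ρ + 2)
        ≤ 1 / (100 * (m : ℝ) ^ 5 * (m + 2)) * (m + 2) := by
          gcongr; linarith
      _ = 1 / (100 * (m : ℝ) ^ 5) := by field_simp
  have e5 : 1 / (5 * (m : ℝ) ^ 3) ≤ μ * (1 / (5 * (m : ℝ) ^ 2)) := by
    calc 1 / (5 * (m : ℝ) ^ 3) = 1 / m * (1 / (5 * (m : ℝ) ^ 2)) := by field_simp
      _ ≤ _ := by gcongr
  have e6 : 10 * (m : ℝ) ^ 2 * (1 / (100 * m ^ 5) * x) = 1 / (10 * m ^ 3) * x := by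
    field_simp; norm_num
  have e7 : 1 / (5 * (m : ℝ) ^ 3) * x = 2 * (1 / (10 * m ^ 3) * x) := by ring
  have k1 : 1 / (100 * (m : ℝ) ^ 5 * (m + 2) + 1) * (1 / ρ + 2) * x ≤ 1 / (100 * m ^ 5) * x :=
    mul_le_mul_of_nonneg_right e4 hx0
  have k2 : 1 / (5 * (m : ℝ) ^ 3) * x ≤ μ * (1 / (5 * (m : ℝ) ^ 2)) * x :=
    mul_le_mul_of_nonneg_right e5 hx0
  have k3 : L * (2 / ρ + 2) * w ≤ L * (4 * m) * w := by gcongr; linarith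
  have k4 : 10 * (m : ℝ) ^ 2 * (1 / (100 * (m : ℝ) ^ 5 * (m + 2) + 1) * (1 / ρ + 2) * x +
      L * (2 / ρ + 2) * w) ≤ 10 * (m : ℝ) ^ 2 * (1 / (100 * m ^ 5) * x + L * (4 * m) * w) := by
    gcongr
  have k5 : 1 / (10 * (m : ℝ) ^ 3) * x ≤ y + 40 * m ^ 3 * L * w := by
    rw [mul_add _ (1 / (100 * (m : ℝ) ^ 5) * x), e6] at k4
    linarith
  have k6 : x ≤ 10 * m ^ 3 * (y + 40 * m ^ 3 * L * w) := by
    have : x = 10 * m ^ 3 * (1 / (10 * (m : ℝ) ^ 3) * x) := by field_simp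
    rw [this]; gcongr
  have hm36 : (m : ℝ) ^ 3 ≤ m ^ 6 := pow_le_pow_right₀ hm1 (by norm_num)
  have hmp : (0 : ℝ) ≤ m ^ 6 := by positivity
  have g1 : (m : ℝ) ^ 6 ≤ m ^ 6 * L := le_mul_of_one_le_right hmp hL1
  have g2 : (m : ℝ) ^ 3 * L ≤ m ^ 6 * L := mul_le_mul_of_nonneg_right hm36 (by linarith)
  have g3 : 10 * (m : ℝ) ^ 3 ≤ 1000 * m ^ 6 * L := by linarith
  have g4 : 40 * (m : ℝ) ^ 3 * L ≤ 1000 * m ^ 6 * L := by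
    have : 0 ≤ (m : ℝ) ^ 6 * L := by positivity
    linarith
  calc x ≤ 10 * m ^ 3 * (y + 40 * m ^ 3 * L * w) := k6
    _ ≤ 1000 * m ^ 6 * L * (y + 1000 * m ^ 6 * L * w) := by gcongr

end

/-! ### Computability of the constants and conclusion -/

/-- The constant in the counting bound. -/
def countBoundConst (x : ℕ × ℕ × ℕ) : ℕ :=
  1024 * pointConst x.1 x.2.1 (growthConst x.2.1 x.2.2)

theorem primrec_pow_const {α : Type*} [Primcodable α] {f : α → ℕ} (hf : Primrec f) (n : ℕ) :
    Primrec fun x => f x ^ n := by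
  induction n with
  | zero => simpa using Primrec.const (α := α) 1
  | succ n ih => simpa only [pow_succ] using Primrec.nat_mul.comp ih hf

theorem primrec_add {α : Type*} [Primcodable α] {f g : α → ℕ} (hf : Primrec f) (hg : Primrec g) :
    Primrec fun x => f x + g x := Primrec.nat_add.comp hf hg

theorem primrec_mul {α : Type*} [Primcodable α] {f g : α → ℕ} (hf : Primrec f) (hg : Primrec g) :
    Primrec fun x => f x * g x := Primrec.nat_mul.comp hf hg

theorem computable_precision : Computable precision := by
  unfold precision
  exact (primrec_mul (primrec_mul (.const _) (primrec_pow_const .id 5))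
    (primrec_add .id (.const 2))).to_comp

theorem primrec_growthConst {α : Type*} [Primcodable α] {m r : α → ℕ} (hm : Primrec m)
    (hr : Primrec r) : Primrec fun x => growthConst (m x) (r x) := by
  unfold growthConst errorConst countConst
  have hr1 := primrec_add hr (.const 1)
  exact primrec_mul (primrec_mul (.const 1000) (primrec_pow_const hm 6))
    (primrec_mul (primrec_add (primrec_mul (primrec_add hm (.const 1)) hr1) hm) hr1)

theorem primrec_diskConst {α : Type*} [Primcodable α] {d m p : α → ℕ} (hd : Primrec d)
    (hm : Primrec m) (hp : Primrec p) : Primrec fun x => diskConst (d x) (m x) (p x) := by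
  unfold diskConst
  exact primrec_mul
    (primrec_add (primrec_add (primrec_mul (.const 2) hp) (primrec_mul (.const 2) hm)) (.const 2))
    (primrec_pow_const (primrec_mul (primrec_mul (.const 2) (primrec_pow_const hp 2)) hd) 2)

theorem primrec_degreeConst {α : Type*} [Primcodable α] {d m p : α → ℕ} (hd : Primrec d)
    (hm : Primrec m) (hp : Primrec p) : Primrec fun x => degreeConst (d x) (m x) (p x) := by
  unfold degreeConst
  exact primrec_mul (primrec_mul (.const 1200) (primrec_pow_const hd 4)) (primrec_diskConst hd hm hp)

theorem primrec_radiusConst {α : Type*} [Primcodable α] {d m p : α → ℕ} (hd : Primrec d)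
    (hm : Primrec m) (hp : Primrec p) : Primrec fun x => radiusConst (d x) (m x) (p x) := by
  unfold radiusConst
  have hT := primrec_degreeConst hd hm hp
  exact primrec_add (primrec_mul hp (primrec_add (primrec_add
    (primrec_mul (primrec_mul (.const 6) (primrec_diskConst hd hm hp)) hT)
    (primrec_mul (primrec_mul (.const 2) hm) hT)) hp)) (.const 1)

theorem primrec_pointConst {α : Type*} [Primcodable α] {d m p : α → ℕ} (hd : Primrec d)
    (hm : Primrec m) (hp : Primrec p) : Primrec fun x => pointConst (d x) (m x) (p x) := by
  unfold pointConst
  exact primrec_mul (primrec_mul (.const 4) (primrec_mul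
    (primrec_add (primrec_add (primrec_mul (.const 5) hp) (primrec_mul (.const 2) hm)) (.const 3))
    (primrec_pow_const (primrec_radiusConst hd hm hp) 2))) (primrec_degreeConst hd hm hp)

theorem computable_countBoundConst : Computable countBoundConst := by
  unfold countBoundConst
  have hm : Primrec fun x : ℕ × ℕ × ℕ => x.2.1 := Primrec.fst.comp Primrec.snd
  have hr : Primrec fun x : ℕ × ℕ × ℕ => x.2.2 := Primrec.snd.comp Primrec.snd
  exact (primrec_mul (.const 1024)
    (primrec_pointConst Primrec.fst hm (primrec_growthConst hm hr))).to_comp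

/-- Already `γ ≥ 16`, because its numerator is at least `2` and its denominator `λρ / 2` at most `1
/ 8`. So the bound `O(ℓ ^ 10)` is enough. -/
theorem ten_le_expo {lam rho : ℝ} (h0 : 0 < lam) (h1 : lam ≤ rho) (h2 : rho ≤ 1 / 2) :
    10 ≤ expo lam rho := by
  have hr : 0 < rho := h0.trans_le h1
  have hg : 16 ≤ (2 * (1 + rho) + rho) / (lam / 2 * rho) := by
    rw [le_div_iff₀ (by positivity)]; nlinarith
  simp only [expo]
  rw [le_div_iff₀ hr]
  nlinarith

theorem countBound_countBoundConst {a : ℕ → ℝ} {lam rho mu phi : ℝ} {d m r₁ : ℕ}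
    (ha : Admissible a lam rho mu) (hphi : 0 < phi) (hphi' : phi < Real.pi / 2) (hd : 1 ≤ d)
    (hlam : 1 / (m : ℝ) ≤ lam) (hmphi : 1 / (m : ℝ) ≤ phi) (hmu : 1 / (m : ℝ) ≤ mu)
    (hmu' : mu ≤ m)
    (hr₁ : ∀ r : ℝ, (r₁ : ℝ) ≤ r →
      |(zeroCount a r : ℝ) / r ^ rho - mu| ≤ 1 / ((precision m : ℝ) + 1)) :
    CountBound a lam rho phi d (countBoundConst (d, m, r₁)) := by
  have hm : 1 ≤ m := by
    rw [Nat.one_le_iff_ne_zero]; rintro rfl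
    exact absurd hmu' (not_le.2 (by simpa using ha.mu_pos))
  have hmrho := hlam.trans ha.lam_le_rho
  have hrho := ha.lam_pos.trans_le ha.lam_le_rho
  intro H hH
  have hH0 : 0 < H := (Real.exp_pos 1).trans hH
  have hlog : 1 < Real.log H := by rwa [Real.lt_log_iff_exp_lt hH0]
  have hH1 : 1 ≤ H := by
    by_contra! h
    exact absurd (Real.log_nonpos hH0.le h.le) (by linarith)
  have hε1 : 1 / ((precision m : ℝ) + 1) ≤ 1 := by
    rw [div_le_one (by positivity)]; linarith [(Nat.cast_nonneg (precision m) : (0 : ℝ) ≤ _)]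
  have hℓ1 : 1 ≤ ⌈Real.log H⌉₊ := Nat.one_le_iff_ne_zero.2 (Nat.ceil_pos.2 (by linarith)).ne'
  have hp : 1 ≤ growthConst m r₁ :=
    Nat.mul_pos (by positivity) (Nat.mul_pos (by omega) (Nat.succ_pos _))
  obtain ⟨hfin, hcard⟩ := algPoints_bound_of_growth
    (differentiable_canonicalProduct ha.one_le ha.summable) hd hm hp hℓ1 hrho hmrho ha.rho_le_half
    (by linarith [Real.pi_pos] : phi < Real.pi) hH1 (Nat.le_ceil _)
    (norm_canonicalProduct_le_growthConst ha.one_le ha.summable hm hmrho ha.rho_le_half hmu' hε1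
      hr₁)
    (fun z hz y hy0 hy => rpow_le_of_log_norm_le ha.one_le ha.summable hm hmrho ha.rho_le_half
      hphi hmphi hmu hmu' hr₁ hz hy0 hy)
  refine ⟨hfin, ?_⟩
  -- Rounding `log H > 1` up at most doubles it; the tenth power of this `2` is the `1024` in
  -- `countBoundConst`.
  have hℓ2 : (⌈Real.log H⌉₊ : ℝ) ≤ 2 * Real.log H := by
    linarith [Nat.ceil_lt_add_one (show 0 ≤ Real.log H by linarith)]
  have hexp : Real.log H ^ 10 ≤ Real.log H ^ expo lam rho := by
    rw [← Real.rpow_natCast]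
    exact Real.rpow_le_rpow_of_exponent_le hlog.le
      (by exact_mod_cast ten_le_expo ha.lam_pos ha.lam_le_rho ha.rho_le_half)
  rw [countBoundConst]
  push_cast
  calc ((algPoints (canonicalProduct a) phi d H).ncard : ℝ)
      ≤ pointConst d m (growthConst m r₁) * (⌈Real.log H⌉₊ : ℝ) ^ 10 := by exact_mod_cast hcard
    _ ≤ pointConst d m (growthConst m r₁) * (2 * Real.log H) ^ 10 := by gcongr
    _ = 1024 * pointConst d m (growthConst m r₁) * Real.log H ^ 10 := by ring
    _ ≤ _ := by gcongr

/-- The qualitative statement follows from the effective one: a large `m` meets the four numerical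
bounds, and convergence of the density supplies `r₁` for the precision that belongs to this `m`. -/
theorem exists_countBound {a : ℕ → ℝ} {lam rho mu phi : ℝ} {d : ℕ}
    (ha : Admissible a lam rho mu) (hphi : 0 < phi) (hphi' : phi < Real.pi / 2) (hd : 1 ≤ d) :
    ∃ C : ℝ, 0 < C ∧ CountBound a lam rho phi d C := by
  have hev : ∀ x : ℝ, 0 < x → ∀ᶠ m : ℕ in atTop, 1 / (m : ℝ) ≤ x := fun x hx =>
    (tendsto_one_div_atTop_nhds_zero_nat.eventually (ge_mem_nhds hx))
  obtain ⟨m, h1, h2, h3, h4⟩ := ((hev lam ha.lam_pos).and ((hev phi hphi).and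
    ((hev mu ha.mu_pos).and (tendsto_natCast_atTop_atTop.eventually_ge_atTop mu)))).exists
  have hε : 0 < 1 / ((precision m : ℝ) + 1) := by positivity
  obtain ⟨R, hR⟩ := eventually_atTop.1 (Metric.tendsto_nhds.1 ha.density _ hε)
  have hb := countBound_countBoundConst (r₁ := ⌈R⌉₊) ha hphi hphi' hd h1 h2 h3 h4 fun r hr =>
    (hR r ((Nat.le_ceil R).trans hr)).le
  -- The added `1` makes the positivity of the constant immediate.
  refine ⟨countBoundConst (d, m, ⌈R⌉₊) + 1, by positivity, fun H hH => ⟨(hb H hH).1, ?_⟩⟩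
  refine (hb H hH).2.trans ?_
  have hlog : 0 ≤ Real.log H := Real.log_nonneg (by linarith [Real.add_one_le_exp (1 : ℝ)])
  have := Real.rpow_nonneg hlog (expo lam rho)
  gcongr
  linarith

end AlgPts

end

/-- The first part is the bound itself; the second part says that the constant is effective: it is
the value of a computable function at `d`, at an integer `m` that bounds `1/λ`, `1/φ`, `1/μ` and
`μ`, and at a radius `r₁` from which on `n(r) / r ^ ρ` is within `1 / (κ(m) + 1)` of its limit `μ`,
with a computable precision `κ`. -/
theorem mainTheorem1 :
    (∀ (a : ℕ → ℝ) (lam rho mu phi : ℝ) (d : ℕ),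
      AlgPts.Admissible a lam rho mu → 0 < phi → phi < Real.pi / 2 → 1 ≤ d →
        ∃ C : ℝ, 0 < C ∧ AlgPts.CountBound a lam rho phi d C) ∧
    (∃ (κ : ℕ → ℕ) (C : ℕ × ℕ × ℕ → ℕ), Computable κ ∧ Computable C ∧
      ∀ (a : ℕ → ℝ) (lam rho mu phi : ℝ) (d m r₁ : ℕ),
        AlgPts.Admissible a lam rho mu → 0 < phi → phi < Real.pi / 2 → 1 ≤ d →
        1 / (m : ℝ) ≤ lam → 1 / (m : ℝ) ≤ phi → 1 / (m : ℝ) ≤ mu → mu ≤ (m : ℝ) →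
        (∀ r : ℝ, (r₁ : ℝ) ≤ r →
          |(AlgPts.zeroCount a r : ℝ) / r ^ rho - mu| ≤ 1 / ((κ m : ℝ) + 1)) →
        AlgPts.CountBound a lam rho phi d (C (d, m, r₁) : ℝ)) :=
  ⟨fun _ _ _ _ _ _ ha hphi hphi' hd => AlgPts.exists_countBound ha hphi hphi' hd,
    AlgPts.precision, AlgPts.countBoundConst, AlgPts.computable_precision,
    AlgPts.computable_countBoundConst,
    fun _ _ _ _ _ _ _ _ ha hphi hphi' hd hlam hmphi hmu hmu' hr =>
      AlgPts.countBound_countBoundConst ha hphi hphi' hd hlam hmphi hmu hmu' hr⟩
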